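/- Let $N\ge 1$ be an integer, $s\in(0,1)$ and $q\in(1,2)$. For a function $u$ on $\mathbb R^N$ put $$[u]^2=\int_{\mathbb R^N}\int_{\mathbb R^N}\frac{(u(x)-u(y))^2}{|x-y|^{N+2s}}\,dx\,dy .$$ For an open set $\Omega\subset\mathbb R^N$ let $$\lambda_1(\Omega,s,2)=\inf\Big\{[\varphi]^2:\ \varphi\in C_0^\infty(\Omega),\ \int_\Omega|\varphi|^2\,dx=1\Big\}\in[0,\infty],$$ with the convention $\inf\emptyset=+\infty$. For a bounded open set $U\subset\mathbb R^N$ let $\mathcal D^{s,2}_0(U)$ be the completion of $C_0^\infty(U)$ with respect to the norm $[\,\cdot\,]$ (a space of functions, extended by zero outside $U$), and let $w_{U,s,q}$ be the minimiser (unique up to null sets) of $$\varphi\mapsto \frac12[\varphi]^2-\frac1q\int_U\varphi^q\,dx$$ among all $\varphi\in\mathcal D^{s,2}_0(U)$ with $\varphi\ge0$ a.e. in $U$. For an arbitrary open set $\Omega\subset\mathbb R^N$ let the $(s,q)$-Lane--Emden density $w_{\Omega,s,q}\colon\Omega\to[0,\infty]$ be defined by $$w_{\Omega,s,q}(x)=\lim_{r\to\infty}w_{\Omega\cap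 B_r,s,q}(x)\qquad\text{for a.e. }x\in\Omega,$$ where $B_r$ is the ball of radius $r$ centred at the origin. Then the following hold. 1. There is a constant $C>0$, depending only on $N$, $s$ and $q$, such that for every open set $\Omega\subset\mathbb R^N$ with $\lambda_1(\Omega,s,2)>0$ one has $w_{\Omega,s,q}\in L^\infty(\Omega)$ and $$\|w_{\Omega,s,q}\|_{L^\infty(\Omega)}^{2-q}\le C\,\lambda_1(\Omega,s,2)^{-1}.$$ 2. Conversely, for every open set $\Omega\subset\mathbb R^N$ with $w_{\Omega,s,q}\in L^\infty(\Omega)$ one has $$\lambda_1(\Omega,s,2)\ge\|w_{\Omega,s,q}\|_{L^\infty(\Omega)}^{q-2}.$$ (For $\Omega=\emptyset$ the conventions $0^{q-2}=+\infty$ and $(+\infty)^{-1}=0$ are used.) -/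

import Mathlib

open MeasureTheory Filter Topology Metric
open scoped ENNReal NNReal ContDiff

namespace FracLaneEmden

/-- Membership in `C₀^∞(Ω)`: smooth functions whose support is a compact subset of `Ω`. -/
def IsTestFunction {N : ℕ} (Ω : Set (EuclideanSpace ℝ (Fin N)))
    (φ : EuclideanSpace ℝ (Fin N) → ℝ) : Prop :=
  ContDiff ℝ ∞ φ ∧ HasCompactSupport φ ∧ tsupport φ ⊆ Ω

/-- The double integral `∫∫ (u(x) - u(y))² / |x - y|^(N + 2s) dx dy` over `ℝ^N × ℝ^N`,
with values in `[0, ∞]`. -/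
noncomputable def energy {N : ℕ} (s : ℝ) (u : EuclideanSpace ℝ (Fin N) → ℝ) : ℝ≥0∞ :=
  ∫⁻ x, ∫⁻ y, ENNReal.ofReal ((u x - u y) ^ 2 / ‖x - y‖ ^ ((N : ℝ) + 2 * s))

/-- The first `q`-semilinear `s`-eigenvalue `λ₁(Ω, s, q)`, as an infimum in `[0, ∞]`
(so that it is `∞` for the empty set). -/
noncomputable def firstEigenvalue {N : ℕ} (Ω : Set (EuclideanSpace ℝ (Fin N))) (s q : ℝ) :
    ℝ≥0∞ :=
  ⨅ (φ : EuclideanSpace ℝ (Fin N) → ℝ) (_ : IsTestFunction Ω φ)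
    (_ : ∫ x in Ω, |φ x| ^ q = 1), energy s φ

/-- Membership in `𝓓₀^{s,2}(U)`, the completion of `C₀^∞(U)` for the square root of `energy s`,
realised as a space of functions on `ℝ^N` (vanishing a.e. outside `U`): the element represented
by a Cauchy sequence of test functions is its limit `u`, the sequence being chosen (up to a
subsequence) so that it also converges to `u` almost everywhere. This is the completion whenever
the latter embeds in some `L^p(U)`, in particular for every bounded open `U`. -/
def MemD {N : ℕ} (U : Set (EuclideanSpace ℝ (Fin N))) (s : ℝ)
    (u : EuclideanSpace ℝ (Fin N) → ℝ) : Prop :=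
  ∃ φ : ℕ → EuclideanSpace ℝ (Fin N) → ℝ,
    (∀ n, IsTestFunction U (φ n)) ∧
    (∀ᵐ x, Tendsto (fun n => φ n x) atTop (𝓝 (u x))) ∧
    Tendsto (fun n => energy s (φ n - u)) atTop (𝓝 0)

/-- The free energy `½ ∫∫ (u(x) - u(y))² / |x - y|^(N + 2s) dx dy - (1/q) ∫_U u^q dx`
of a non-negative `u ∈ 𝓓₀^{s,2}(U)` (both terms are finite if `U` is bounded and `1 < q < 2`). -/
noncomputable def freeEnergy {N : ℕ} (U : Set (EuclideanSpace ℝ (Fin N))) (s q : ℝ)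
    (u : EuclideanSpace ℝ (Fin N) → ℝ) : ℝ :=
  1 / 2 * (energy s u).toReal - 1 / q * ∫ x in U, u x ^ q

/-- `u` is (a representative of) the Lane-Emden density of a bounded open set `U`: it minimises
the free energy among the functions of `𝓓₀^{s,2}(U)` that are non-negative a.e. in `U`. -/
def IsBoundedDensity {N : ℕ} (U : Set (EuclideanSpace ℝ (Fin N))) (s q : ℝ)
    (u : EuclideanSpace ℝ (Fin N) → ℝ) : Prop :=
  (MemD U s u ∧ ∀ᵐ x ∂(volume.restrict U), 0 ≤ u x) ∧
  ∀ v : EuclideanSpace ℝ (Fin N) → ℝ,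
    MemD U s v → (∀ᵐ x ∂(volume.restrict U), 0 ≤ v x) → freeEnergy U s q u ≤ freeEnergy U s q v

/-- `w : ℝ^N → [0, ∞]` is (a representative of) the Lane-Emden density `w_{Ω,s,q}` of an
arbitrary open set `Ω`: a.e. in `Ω` it is the limit, as `r → ∞`, of the Lane-Emden densities of
the bounded sets `Ω ∩ B_r`. Its values outside `Ω` are irrelevant. -/
def IsLaneEmdenDensity {N : ℕ} (Ω : Set (EuclideanSpace ℝ (Fin N))) (s q : ℝ)
    (w : EuclideanSpace ℝ (Fin N) → ℝ≥0∞) : Prop :=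
  ∃ v : ℝ → EuclideanSpace ℝ (Fin N) → ℝ,
    (∀ r, 0 < r → IsBoundedDensity (Ω ∩ ball 0 r) s q (v r)) ∧
    ∀ᵐ x ∂(volume.restrict Ω),
      Tendsto (fun r => ENNReal.ofReal (v r x)) atTop (𝓝 (w x))

end FracLaneEmden

/-! The density `u` of a bounded set formally solves `(-Δ)^s u = u^(q-1)`, but only its minimality
is used, tested against two families of competitors.

Upper bound. Suppose `u ≤ M`, and put `K = M/8`, `μ = K^(q-2)`. Where `u ≥ K`, sublinearity gives
`u^(q-1) ≤ μ u`, a linear problem with natural length `R ~ μ^(-1/(2s))`. Compare `u` with the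
varying level `K H`, where `H` is smooth, equal to `1` near `x₀` and to `9` off `B_R(x₀)`. Since `u
≤ 8K`, the truncation `(u - K H)₊` lives in `B_R(x₀)`, so no nonlocal tail has to be estimated.
Testing minimality with `u - (u - K H)₊` bounds its energy by a multiple of `μ K² R^N`
(`IsBoundedDensity.energy_posPart_le`), and the eigenvalue bounds its squared `L²` norm by a
multiple of `μ K² R^N / λ₁`. When `μ ≤ c λ₁` this is small enough to start a De Giorgi iteration
(`IsBoundedDensity.ae_le_of_lintegral_le`), driven by the Faber–Krahn inequality
`lintegral_sq_le_energy`; it yields `u ≤ 2 K H`, hence `u ≤ M/2` near every `x₀` (`exists_halving`).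
Starting from a qualitative bound, `M` can be halved until `(M/8)^(q-2)` exceeds `c λ₁`. Nothing
depends on the size of the set, so the bound survives `r → ∞`.

Lower bound. The competitor `√(u² + t φ²)` has energy at most `[u]² + t [φ]²`, while `a ↦ a^(q/2)`
is concave. Minimality therefore gives `∫ φ² (u² + t φ²)^(q/2 - 1) ≤ [φ]²`
(`IsBoundedDensity.lintegral_sq_mul_rpow_le`). If the limit density is at most `m`, Fatou's lemma
and then `t → 0` give `m^(q-2) ∫ φ² ≤ [φ]²`. -/

namespace FracLaneEmden

/-! ### The energy as an `L²` norm on pairs of points -/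

/-- The ambient space `ℝ^N`. -/
abbrev Pt (N : ℕ) : Type := EuclideanSpace ℝ (Fin N)

/-- The measure `|x - y|^(-N-2s) dx dy` on `ℝ^N × ℝ^N`. -/
noncomputable def pairMeasure (N : ℕ) (s : ℝ) : Measure (Pt N × Pt N) :=
  ((volume : Measure (Pt N)).prod volume).withDensity
    fun p => ENNReal.ofReal (‖p.1 - p.2‖ ^ ((N : ℝ) + 2 * s))⁻¹

theorem measurable_kernel (N : ℕ) (s : ℝ) :
    Measurable fun p : Pt N × Pt N => ENNReal.ofReal (‖p.1 - p.2‖ ^ ((N : ℝ) + 2 * s))⁻¹ := by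
  fun_prop

theorem pairMeasure_absolutelyContinuous (N : ℕ) (s : ℝ) :
    pairMeasure N s ≪ (volume : Measure (Pt N)).prod volume :=
  withDensity_absolutelyContinuous _ _

theorem ae_pairMeasure_fst {N : ℕ} (s : ℝ) {P : Pt N → Prop} (h : ∀ᵐ x, P x) :
    ∀ᵐ p ∂pairMeasure N s, P p.1 :=
  (pairMeasure_absolutelyContinuous N s).ae_le
    (Measure.quasiMeasurePreserving_fst.ae h)

theorem ae_pairMeasure_snd {N : ℕ} (s : ℝ) {P : Pt N → Prop} (h : ∀ᵐ x, P x) :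
    ∀ᵐ p ∂pairMeasure N s, P p.2 :=
  (pairMeasure_absolutelyContinuous N s).ae_le
    (Measure.quasiMeasurePreserving_snd.ae h)

theorem aemeasurable_pair_fst {N : ℕ} (s : ℝ) {u : Pt N → ℝ} (hu : AEMeasurable u) :
    AEMeasurable (fun p : Pt N × Pt N => u p.1) (pairMeasure N s) :=
  (hu.comp_quasiMeasurePreserving Measure.quasiMeasurePreserving_fst).mono_ac
    (pairMeasure_absolutelyContinuous N s)

theorem aemeasurable_pair_snd {N : ℕ} (s : ℝ) {u : Pt N → ℝ} (hu : AEMeasurable u) :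
    AEMeasurable (fun p : Pt N × Pt N => u p.2) (pairMeasure N s) :=
  (hu.comp_quasiMeasurePreserving Measure.quasiMeasurePreserving_snd).mono_ac
    (pairMeasure_absolutelyContinuous N s)

theorem aemeasurable_pair_sub {N : ℕ} (s : ℝ) {u : Pt N → ℝ} (hu : AEMeasurable u) :
    AEMeasurable (fun p : Pt N × Pt N => u p.1 - u p.2) (pairMeasure N s) :=
  (aemeasurable_pair_fst s hu).sub (aemeasurable_pair_snd s hu)

/-- With a single measure on pairs, the energy is the squared `L²` norm of the increment. Pointwise
inequalities between increments then integrate at once, and dominated convergence applies. -/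
theorem energy_eq_lintegral {N : ℕ} (s : ℝ) {u : Pt N → ℝ} (hu : AEMeasurable u) :
    energy s u = ∫⁻ p, ENNReal.ofReal ((u p.1 - u p.2) ^ 2) ∂pairMeasure N s := by
  have h1 : AEMeasurable (fun p : Pt N × Pt N => ENNReal.ofReal ((u p.1 - u p.2) ^ 2))
      ((volume : Measure (Pt N)).prod volume) :=
    (((hu.comp_quasiMeasurePreserving Measure.quasiMeasurePreserving_fst).sub
      (hu.comp_quasiMeasurePreserving Measure.quasiMeasurePreserving_snd)).pow_const 2).ennreal_ofReal
  rw [pairMeasure, lintegral_withDensity_eq_lintegral_mul₀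
    (measurable_kernel N s).aemeasurable h1, lintegral_prod _
    ((measurable_kernel N s).aemeasurable.mul h1)]
  unfold energy
  refine lintegral_congr fun x => lintegral_congr fun y => ?_
  rw [Pi.mul_apply, ← ENNReal.ofReal_mul (by positivity), div_eq_inv_mul]

theorem energy_congr_ae {N : ℕ} (s : ℝ) {u v : Pt N → ℝ} (h : u =ᵐ[volume] v) :
    energy s u = energy s v := by
  unfold energy
  refine lintegral_congr_ae ?_
  filter_upwards [h] with x hx
  refine lintegral_congr_ae ?_
  filter_upwards [h] with y hy
  rw [hx, hy]

/-! ### Bounds on fractional gradients -/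

/-- The truncated kernel `min(1, |z|²) |z|^(-N-2s)` is integrable. -/
theorem lintegral_truncated_kernel_lt_top {N : ℕ} (hN : 1 ≤ N) {s : ℝ}
    (hs : s ∈ Set.Ioo (0 : ℝ) 1) :
    ∫⁻ z : Pt N, ENNReal.ofReal (min 1 (‖z‖ ^ 2) / ‖z‖ ^ ((N : ℝ) + 2 * s)) < ⊤ := by
  have : Nonempty (Fin N) := ⟨⟨0, hN⟩⟩
  obtain ⟨hs0, hs1⟩ := hs
  have hint : Integrable (fun z : Pt N =>
      (fun r : ℝ => min 1 (r ^ 2) / r ^ ((N : ℝ) + 2 * s)) ‖z‖) := by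
    refine (integrable_fun_norm_addHaar (volume : Measure (Pt N))
      (f := fun r : ℝ => min 1 (r ^ 2) / r ^ ((N : ℝ) + 2 * s))).2 ?_
    simp only [finrank_euclideanSpace, Fintype.card_fin, smul_eq_mul]
    have hpow : ∀ r : ℝ, 0 < r → ((r ^ (N - 1) : ℝ)) = r ^ ((N : ℝ) - 1) := fun r hr => by
      rw [← Real.rpow_natCast, Nat.cast_sub hN, Nat.cast_one]
    -- In polar coordinates the integrand is `r^(1-2s)` near `0`, integrable because `s < 1`, and
    -- `r^(-1-2s)` at infinity, integrable because `s > 0`.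
    rw [← Set.Ioo_union_Ici_eq_Ioi (show (0 : ℝ) < 1 by norm_num), integrableOn_union]
    constructor
    · refine ((intervalIntegral.integrableOn_Ioo_rpow_iff (s := 1 - 2 * s)
        (show (0 : ℝ) < 1 by norm_num)).2 (by linarith)).congr_fun (fun r hr => ?_)
        measurableSet_Ioo
      have h0 : 0 < r := hr.1
      simp only
      rw [min_eq_right (by nlinarith [hr.1, hr.2]), hpow r h0, ← Real.rpow_natCast r 2,
        ← Real.rpow_sub h0, ← Real.rpow_add h0]
      congr 1
      push_cast
      ring
    · rw [integrableOn_Ici_iff_integrableOn_Ioi]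
      refine (integrableOn_Ioi_rpow_of_lt (a := -1 - 2 * s) (by linarith)
        (show (0 : ℝ) < 1 by norm_num)).congr_fun (fun r hr => ?_) measurableSet_Ioi
      have h1 : 1 < r := hr
      have h0 : 0 < r := by linarith
      simp only
      rw [min_eq_left (by nlinarith), hpow r h0, one_div, ← Real.rpow_neg h0.le,
        ← Real.rpow_add h0]
      congr 1
      ring
  have := hint.lintegral_lt_top
  exact this

/-- The integral of the truncated kernel. -/
noncomputable def truncConst (N : ℕ) (s : ℝ) : ℝ :=
  (∫⁻ z : Pt N, ENNReal.ofReal (min 1 (‖z‖ ^ 2) / ‖z‖ ^ ((N : ℝ) + 2 * s))).toReal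

theorem truncConst_nonneg (N : ℕ) (s : ℝ) : 0 ≤ truncConst N s := ENNReal.toReal_nonneg

theorem lintegral_comp_smul_eq {N : ℕ} (f : Pt N → ℝ≥0∞) {r : ℝ} (hr : 0 < r) :
    ∫⁻ z, f (r • z) = ENNReal.ofReal ((r ^ N)⁻¹) * ∫⁻ z, f z := by
  have h := Measure.map_addHaar_smul (volume : Measure (Pt N)) hr.ne'
  rw [finrank_euclideanSpace_fin, abs_of_pos (by positivity)] at h
  have h2 := lintegral_map_equiv (μ := (volume : Measure (Pt N))) f
    (Homeomorph.smulOfNeZero r hr.ne').toMeasurableEquiv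
  have h3 : ((Homeomorph.smulOfNeZero r hr.ne').toMeasurableEquiv : Pt N → Pt N) = (r • ·) := rfl
  rw [h3, h, lintegral_smul_measure, smul_eq_mul] at h2
  exact h2.symm

/-- Bound of the squared fractional gradient of a bounded Lipschitz function. -/
theorem lintegral_gradient_le {N : ℕ} (hN : 1 ≤ N) {s : ℝ} (hs : s ∈ Set.Ioo (0 : ℝ) 1)
    {h : Pt N → ℝ} {c R : ℝ} (hc : 0 ≤ c) (hR : 0 < R)
    (hh : ∀ x y, (h x - h y) ^ 2 ≤ c * min 1 ((‖x - y‖ / R) ^ 2)) (x : Pt N) :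
    ∫⁻ y, ENNReal.ofReal ((h x - h y) ^ 2 / ‖x - y‖ ^ ((N : ℝ) + 2 * s)) ≤
      ENNReal.ofReal (c * truncConst N s * R ^ (-(2 * s))) := by
  have hK := lintegral_truncated_kernel_lt_top hN hs
  set f : Pt N → ℝ≥0∞ := fun z =>
    ENNReal.ofReal (c * (min 1 ((‖z‖ / R) ^ 2) / ‖z‖ ^ ((N : ℝ) + 2 * s))) with hf
  have h1 : ∫⁻ y, ENNReal.ofReal ((h x - h y) ^ 2 / ‖x - y‖ ^ ((N : ℝ) + 2 * s)) ≤
      ∫⁻ y, f (x - y) := by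
    refine lintegral_mono fun y => ENNReal.ofReal_le_ofReal ?_
    rw [← mul_div_assoc]
    exact div_le_div_of_nonneg_right (hh x y) (by positivity)
  refine h1.trans ?_
  rw [lintegral_sub_left_eq_self f x]
  -- Rescaling by `R` reduces to unit scale: the kernel gives `R^(-N-2s)` and Lebesgue measure
  -- `R^N`.
  have h2 := lintegral_comp_smul_eq f hR
  have h3 : ∫⁻ z : Pt N, f (R • z) = ENNReal.ofReal (c * R ^ (-((N : ℝ) + 2 * s))) *
      ENNReal.ofReal (truncConst N s) := by
    rw [truncConst, ENNReal.ofReal_toReal hK.ne, ← lintegral_const_mul' _ _ (by finiteness)]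
    refine lintegral_congr fun z => ?_
    rw [hf, ← ENNReal.ofReal_mul (by positivity)]
    simp only
    rw [norm_smul, Real.norm_eq_abs, abs_of_pos hR, mul_div_cancel_left₀ _ hR.ne',
      Real.mul_rpow hR.le (norm_nonneg z), Real.rpow_neg hR.le]
    congr 1
    field_simp
  rw [h3, ← ENNReal.ofReal_mul (by positivity)] at h2
  have hRN : (0 : ℝ) < R ^ N := by positivity
  have h4 : ∫⁻ z, f z = ENNReal.ofReal (R ^ N) * (ENNReal.ofReal ((R ^ N)⁻¹) * ∫⁻ z, f z) := by
    rw [← mul_assoc, ← ENNReal.ofReal_mul hRN.le, mul_inv_cancel₀ hRN.ne', ENNReal.ofReal_one,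
      one_mul]
  rw [h4, ← h2, ← ENNReal.ofReal_mul hRN.le]
  refine ENNReal.ofReal_le_ofReal (le_of_eq ?_)
  rw [neg_add, Real.rpow_add hR, Real.rpow_neg hR.le, Real.rpow_natCast]
  field_simp

/-- By symmetry of the kernel each of `x ∈ A` and `y ∈ A` costs `Γ * volume A`, on integrating first
over the other variable. -/
theorem lintegral_indicator_or_le {N : ℕ} {s : ℝ} {h : Pt N → ℝ} (hm : Measurable h) {Γ : ℝ≥0∞}
    (hΓ : ∀ x, ∫⁻ y, ENNReal.ofReal ((h x - h y) ^ 2 / ‖x - y‖ ^ ((N : ℝ) + 2 * s)) ≤ Γ)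
    {A : Set (Pt N)} (hA : MeasurableSet A) :
    ∫⁻ p, {p : Pt N × Pt N | p.1 ∈ A ∨ p.2 ∈ A}.indicator
      (fun p => ENNReal.ofReal ((h p.1 - h p.2) ^ 2)) p ∂pairMeasure N s ≤ 2 * Γ * volume A := by
  set F : Pt N × Pt N → ℝ≥0∞ := fun p => ENNReal.ofReal ((h p.1 - h p.2) ^ 2) with hF
  have hFm : Measurable F := by fun_prop
  have hA1 : MeasurableSet {p : Pt N × Pt N | p.1 ∈ A} := measurable_fst hA
  have hA2 : MeasurableSet {p : Pt N × Pt N | p.2 ∈ A} := measurable_snd hA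
  have hkey : ∀ x y, ENNReal.ofReal (‖x - y‖ ^ ((N : ℝ) + 2 * s))⁻¹ * F (x, y) =
      ENNReal.ofReal ((h x - h y) ^ 2 / ‖x - y‖ ^ ((N : ℝ) + 2 * s)) := fun x y => by
    rw [hF, ← ENNReal.ofReal_mul (by positivity), div_eq_inv_mul]
  have e1 : ∫⁻ p, {p : Pt N × Pt N | p.1 ∈ A}.indicator F p ∂pairMeasure N s ≤ Γ * volume A := by
    rw [pairMeasure, lintegral_withDensity_eq_lintegral_mul _ (measurable_kernel N s)
      (hFm.indicator hA1), lintegral_prod _ ((measurable_kernel N s).mul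
      (hFm.indicator hA1)).aemeasurable, ← lintegral_indicator_const hA]
    refine lintegral_mono fun x => ?_
    by_cases hx : x ∈ A
    · simp only [Pi.mul_apply, Set.indicator, Set.mem_ofPred_eq, hx, if_true, hkey]
      exact hΓ x
    · simp [Set.indicator, hx]
  have e2 : ∫⁻ p, {p : Pt N × Pt N | p.2 ∈ A}.indicator F p ∂pairMeasure N s ≤ Γ * volume A := by
    rw [pairMeasure, lintegral_withDensity_eq_lintegral_mul _ (measurable_kernel N s)
      (hFm.indicator hA2), lintegral_prod_symm _ ((measurable_kernel N s).mul
      (hFm.indicator hA2)).aemeasurable, ← lintegral_indicator_const hA]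
    refine lintegral_mono fun y => ?_
    by_cases hy : y ∈ A
    · simp only [Pi.mul_apply, Set.indicator, Set.mem_ofPred_eq, hy, if_true, hkey]
      refine le_trans (le_of_eq (lintegral_congr fun x => ?_)) (hΓ y)
      rw [norm_sub_rev, ← neg_sub, neg_sq]
    · simp [Set.indicator, hy]
  calc _ ≤ ∫⁻ p, ({p : Pt N × Pt N | p.1 ∈ A}.indicator F p +
        {p : Pt N × Pt N | p.2 ∈ A}.indicator F p) ∂pairMeasure N s := by
        refine lintegral_mono fun p => ?_
        by_cases h1 : p.1 ∈ A <;> by_cases h2 : p.2 ∈ A <;> simp [Set.indicator, h1, h2]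
    _ = _ := lintegral_add_left (hFm.indicator hA1) _
    _ ≤ Γ * volume A + Γ * volume A := add_le_add e1 e2
    _ = _ := by ring

/-! ### The Faber–Krahn inequality -/

/-- Faber–Krahn type inequality. -/
theorem lintegral_sq_le_energy {N : ℕ} {s : ℝ} (hs : 0 < s) {u : Pt N → ℝ} (hu : Measurable u)
    {r : ℝ} (hr : 0 < r) (hsupp : 2 * volume {x | u x ≠ 0} ≤ volume (ball (0 : Pt N) r)) :
    volume (ball (0 : Pt N) 1) * ∫⁻ x, ENNReal.ofReal (u x ^ 2) ≤
      2 * ENNReal.ofReal (r ^ (2 * s)) * energy s u := by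
  set S := {x | u x ≠ 0} with hS
  have hSm : MeasurableSet S := (hu (measurableSet_singleton 0)).compl
  set V := volume (ball (0 : Pt N) r) with hV
  have hVtop : V ≠ ⊤ := measure_ball_lt_top.ne
  have hStop : volume S ≠ ⊤ := by
    refine ne_top_of_le_ne_top hVtop (le_trans ?_ hsupp)
    rw [two_mul]; exact le_self_add
  have hpt : ∀ x, ENNReal.ofReal (u x ^ 2) * V ≤ 2 * (ENNReal.ofReal (r ^ ((N : ℝ) + 2 * s)) *
      ∫⁻ y, ENNReal.ofReal ((u x - u y) ^ 2 / ‖x - y‖ ^ ((N : ℝ) + 2 * s))) := by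
    intro x
    -- At least half of every ball of radius `r` misses the support. On that half the increment is
    -- `u x` and the kernel is at least `r^(-N-2s)`.
    have hmeas : V ≤ 2 * volume (ball x r \ S) := by
      have h1 : V ≤ volume (ball x r \ S) + volume S := by
        rw [hV, ← Measure.addHaar_ball_center volume x r]
        exact (measure_mono (by intro y hy; by_cases h : y ∈ S <;> simp [h, hy])).trans
          (measure_union_le _ _)
      have h2 : V + V ≤ 2 * volume (ball x r \ S) + V := by
        calc V + V ≤ (volume (ball x r \ S) + volume S) + (volume (ball x r \ S) + volume S) :=
              add_le_add h1 h1
          _ = 2 * volume (ball x r \ S) + 2 * volume S := by ring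
          _ ≤ _ := by gcongr
      exact (ENNReal.add_le_add_iff_right hVtop).1 h2
    calc ENNReal.ofReal (u x ^ 2) * V ≤ ENNReal.ofReal (u x ^ 2) * (2 * volume (ball x r \ S)) := by
          gcongr
      _ = 2 * (ENNReal.ofReal (u x ^ 2) * volume (ball x r \ S)) := by ring
      _ ≤ _ := by
        gcongr 2 * ?_
        rw [← lintegral_indicator_const (measurableSet_ball.diff hSm),
          ← lintegral_const_mul' _ _ (by finiteness)]
        refine lintegral_mono fun y => ?_
        by_cases hy : y ∈ ball x r \ S
        · rw [Set.indicator_of_mem hy, ← ENNReal.ofReal_mul (by positivity)]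
          refine ENNReal.ofReal_le_ofReal ?_
          have huy : u y = 0 := by simpa [hS] using hy.2
          by_cases hxy : x = y
          · subst hxy; simp [huy]
          · have hpos : 0 < ‖x - y‖ := norm_pos_iff.2 (sub_ne_zero.2 hxy)
            have hlt : ‖x - y‖ ≤ r := by
              have := hy.1; rw [mem_ball, dist_comm, dist_eq_norm] at this; exact this.le
            rw [huy, sub_zero, mul_div_assoc', le_div_iff₀ (by positivity), mul_comm]
            gcongr
        · rw [Set.indicator_of_notMem hy]; exact zero_le
  have hV2 : V = ENNReal.ofReal (r ^ N) * volume (ball (0 : Pt N) 1) := by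
    rw [hV, Measure.addHaar_ball_of_pos volume _ hr, finrank_euclideanSpace_fin]
  have hint : (∫⁻ x, ENNReal.ofReal (u x ^ 2)) * V ≤
      2 * (ENNReal.ofReal (r ^ ((N : ℝ) + 2 * s)) * energy s u) := by
    unfold energy
    rw [← lintegral_mul_const' _ _ hVtop, ← lintegral_const_mul' _ _ (by finiteness),
      ← lintegral_const_mul' _ _ (by finiteness)]
    exact lintegral_mono hpt
  have hrN : ENNReal.ofReal (r ^ N) ≠ 0 := by simp; positivity
  rw [Real.rpow_add hr, Real.rpow_natCast, ENNReal.ofReal_mul (by positivity), hV2] at hint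
  refine (ENNReal.mul_le_mul_iff_right hrN ENNReal.ofReal_ne_top).1 ?_
  calc _ = (∫⁻ x, ENNReal.ofReal (u x ^ 2)) * (ENNReal.ofReal (r ^ N) *
        volume (ball (0 : Pt N) 1)) := by ring
    _ ≤ _ := hint
    _ = _ := by ring

/-! ### Test functions and their energy -/

theorem IsTestFunction.continuous {N : ℕ} {U : Set (Pt N)} {φ : Pt N → ℝ}
    (h : IsTestFunction U φ) : Continuous φ := h.1.continuous

theorem IsTestFunction.measurable {N : ℕ} {U : Set (Pt N)} {φ : Pt N → ℝ}
    (h : IsTestFunction U φ) : Measurable φ := h.continuous.measurable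

theorem IsTestFunction.eq_zero {N : ℕ} {U : Set (Pt N)} {φ : Pt N → ℝ}
    (h : IsTestFunction U φ) {x : Pt N} (hx : x ∉ U) : φ x = 0 :=
  image_eq_zero_of_notMem_tsupport fun hx' => hx (h.2.2 hx')

theorem IsTestFunction.mono {N : ℕ} {U V : Set (Pt N)} {φ : Pt N → ℝ}
    (h : IsTestFunction U φ) (hUV : U ⊆ V) : IsTestFunction V φ :=
  ⟨h.1, h.2.1, h.2.2.trans hUV⟩

theorem IsTestFunction.sub {N : ℕ} {U : Set (Pt N)} {φ ψ : Pt N → ℝ}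
    (h : IsTestFunction U φ) (h' : IsTestFunction U ψ) : IsTestFunction U (φ - ψ) :=
  ⟨h.1.sub h'.1, h.2.1.sub h'.2.1, (tsupport_sub _ _).trans (Set.union_subset h.2.2 h'.2.2)⟩

theorem IsTestFunction.const_mul {N : ℕ} {U : Set (Pt N)} {φ : Pt N → ℝ}
    (h : IsTestFunction U φ) (c : ℝ) : IsTestFunction U (fun x => c * φ x) :=
  ⟨contDiff_const.mul h.1, h.2.1.mul_left, (tsupport_mul_subset_right).trans h.2.2⟩

theorem IsTestFunction.exists_bound {N : ℕ} {U : Set (Pt N)} {φ : Pt N → ℝ}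
    (h : IsTestFunction U φ) : ∃ B, 0 ≤ B ∧ ∀ x, |φ x| ≤ B := by
  obtain ⟨B, hB⟩ := h.2.1.exists_bound_of_continuous h.continuous
  exact ⟨max B 0, le_max_right _ _, fun x => (hB x).trans (le_max_left _ _)⟩

/-- The sup bound serves distant pairs and the Lipschitz bound close ones. This is the hypothesis of
`lintegral_gradient_le` with `R = 1`. -/
theorem IsTestFunction.sq_sub_le {N : ℕ} {U : Set (Pt N)} {φ : Pt N → ℝ}
    (h : IsTestFunction U φ) :
    ∃ c, 0 < c ∧ ∀ x y, (φ x - φ y) ^ 2 ≤ c * min 1 (‖x - y‖ ^ 2) := by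
  obtain ⟨B, hB0, hB⟩ := h.exists_bound
  obtain ⟨L, hL⟩ := ContDiff.lipschitzWith_of_hasCompactSupport h.2.1 h.1 (by simp)
  refine ⟨4 * B ^ 2 + (L : ℝ) ^ 2 + 1, by positivity, fun x y => ?_⟩
  have h1 : |φ x - φ y| ≤ 2 * B := (abs_sub _ _).trans (by linarith [hB x, hB y])
  have h2 : |φ x - φ y| ≤ L * ‖x - y‖ := by
    have := hL.dist_le_mul x y
    rwa [Real.dist_eq, dist_eq_norm] at this
  rw [← sq_abs]
  rcases min_cases (1 : ℝ) (‖x - y‖ ^ 2) with ⟨e, _⟩ | ⟨e, _⟩ <;> rw [e]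
  · nlinarith [abs_nonneg (φ x - φ y), sq_nonneg (L : ℝ)]
  · have := pow_le_pow_left₀ (abs_nonneg _) h2 2
    nlinarith [sq_nonneg B, sq_nonneg ‖x - y‖, mul_nonneg (sq_nonneg B) (sq_nonneg ‖x - y‖)]

theorem IsTestFunction.energy_lt_top {N : ℕ} (hN : 1 ≤ N) {s : ℝ} (hs : s ∈ Set.Ioo (0 : ℝ) 1)
    {U : Set (Pt N)} {φ : Pt N → ℝ} (h : IsTestFunction U φ) : energy s φ < ⊤ := by
  obtain ⟨c, hc, hφ⟩ := h.sq_sub_le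
  have hA : MeasurableSet (tsupport φ) := (isClosed_tsupport φ).measurableSet
  have h1 := lintegral_indicator_or_le (s := s) h.measurable
    (lintegral_gradient_le hN hs hc.le one_pos (by simpa using hφ)) hA
  rw [energy_eq_lintegral s h.measurable.aemeasurable]
  refine lt_of_le_of_lt (lintegral_mono fun p => ?_) (lt_of_le_of_lt h1 ?_)
  · by_cases hp : p.1 ∈ tsupport φ ∨ p.2 ∈ tsupport φ
    · rw [Set.indicator_of_mem (by exact hp)]
    · push Not at hp
      simp [image_eq_zero_of_notMem_tsupport hp.1, image_eq_zero_of_notMem_tsupport hp.2]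
  · have : volume (tsupport φ) < ⊤ := h.2.1.measure_lt_top
    finiteness

/-! ### The space `𝓓₀^{s,2}(U)` and dominated convergence in it -/

theorem ofReal_sq_add_le (a b : ℝ) :
    ENNReal.ofReal ((a + b) ^ 2) ≤ 2 * ENNReal.ofReal (a ^ 2) + 2 * ENNReal.ofReal (b ^ 2) := by
  rw [← ENNReal.ofReal_ofNat, ← ENNReal.ofReal_mul (by norm_num),
    ← ENNReal.ofReal_mul (by norm_num), ← ENNReal.ofReal_add (by positivity) (by positivity)]
  exact ENNReal.ofReal_le_ofReal (by nlinarith [sq_nonneg (a - b)])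

theorem lintegral_sq_add_le {α : Type*} [MeasurableSpace α] {μ : Measure α} {a b c : α → ℝ}
    (ha : AEMeasurable a μ) (h : ∀ x, c x = a x + b x) :
    ∫⁻ x, ENNReal.ofReal (c x ^ 2) ∂μ ≤
      2 * ∫⁻ x, ENNReal.ofReal (a x ^ 2) ∂μ + 2 * ∫⁻ x, ENNReal.ofReal (b x ^ 2) ∂μ := by
  rw [← lintegral_const_mul' _ _ (by simp), ← lintegral_const_mul' _ _ (by simp),
    ← lintegral_add_left' ((ha.pow_const 2).ennreal_ofReal.const_mul 2)]
  exact lintegral_mono fun x => by rw [h x]; exact ofReal_sq_add_le _ _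

theorem energy_add_le {N : ℕ} (s : ℝ) {u v w : Pt N → ℝ} (hu : AEMeasurable u)
    (hv : AEMeasurable v) (h : ∀ x, w x = u x + v x) :
    energy s w ≤ 2 * energy s u + 2 * energy s v := by
  have hw : AEMeasurable w := by
    rw [show w = fun x => u x + v x from funext h]; exact hu.add hv
  rw [energy_eq_lintegral s hu, energy_eq_lintegral s hv, energy_eq_lintegral s hw]
  exact lintegral_sq_add_le (aemeasurable_pair_sub s hu) fun p => by rw [h, h]; ring

theorem energy_const_mul {N : ℕ} (s : ℝ) (u : Pt N → ℝ) (c : ℝ) :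
    energy s (fun x => c * u x) = ENNReal.ofReal (c ^ 2) * energy s u := by
  unfold energy
  rw [← lintegral_const_mul' _ _ (by finiteness)]
  refine lintegral_congr fun x => ?_
  rw [← lintegral_const_mul' _ _ (by finiteness)]
  refine lintegral_congr fun y => ?_
  rw [← ENNReal.ofReal_mul (by positivity)]
  congr 1
  ring

theorem MemD.aemeasurable {N : ℕ} {s : ℝ} {U : Set (Pt N)} {u : Pt N → ℝ} (h : MemD U s u) :
    AEMeasurable u := by
  obtain ⟨φ, hφ, hlim, -⟩ := h
  exact aemeasurable_of_tendsto_metrizable_ae atTop (fun n => (hφ n).measurable.aemeasurable) hlim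

theorem MemD.ae_eq_zero {N : ℕ} {s : ℝ} {U : Set (Pt N)} {u : Pt N → ℝ} (h : MemD U s u) :
    ∀ᵐ x, x ∉ U → u x = 0 := by
  obtain ⟨φ, hφ, hlim, -⟩ := h
  filter_upwards [hlim] with x hx hxU
  refine tendsto_nhds_unique hx ?_
  simp [(hφ _).eq_zero hxU]

theorem MemD.congr_ae {N : ℕ} {s : ℝ} {U : Set (Pt N)} {u v : Pt N → ℝ} (h : MemD U s u)
    (huv : u =ᵐ[volume] v) : MemD U s v := by
  obtain ⟨φ, hφ, hlim, hE⟩ := h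
  refine ⟨φ, hφ, ?_, ?_⟩
  · filter_upwards [hlim, huv] with x hx hx'
    rwa [← hx']
  · refine hE.congr fun n => energy_congr_ae s ?_
    filter_upwards [huv] with x hx
    simp [hx]

theorem MemD.energy_lt_top {N : ℕ} (hN : 1 ≤ N) {s : ℝ} (hs : s ∈ Set.Ioo (0 : ℝ) 1)
    {U : Set (Pt N)} {u : Pt N → ℝ} (h : MemD U s u) : energy s u < ⊤ := by
  have hu := h.aemeasurable
  obtain ⟨φ, hφ, hlim, hE⟩ := h
  obtain ⟨n, hn⟩ := ((tendsto_order.1 hE).2 1 one_pos).exists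
  have h1 := energy_add_le s (u := φ n) (v := fun x => -1 * (φ n - u) x) (w := u)
    (hφ n).measurable.aemeasurable (((hφ n).measurable.aemeasurable.sub hu).const_mul _)
    (fun x => by simp)
  rw [energy_const_mul] at h1
  refine lt_of_le_of_lt h1 ?_
  have h2 := (hφ n).energy_lt_top hN hs
  have h3 : energy s (φ n - u) < ⊤ := hn.trans ENNReal.one_lt_top
  exact ENNReal.add_lt_top.2 ⟨ENNReal.mul_lt_top (by simp) h2,
    ENNReal.mul_lt_top (by simp) (ENNReal.mul_lt_top (by simp) h3)⟩

theorem MemD.sub {N : ℕ} {s : ℝ} {U : Set (Pt N)} {u v : Pt N → ℝ} (hu : MemD U s u)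
    (hv : MemD U s v) : MemD U s (u - v) := by
  have hum := hu.aemeasurable
  have hvm := hv.aemeasurable
  obtain ⟨φ, hφ, hφl, hφE⟩ := hu
  obtain ⟨ψ, hψ, hψl, hψE⟩ := hv
  refine ⟨fun n => φ n - ψ n, fun n => (hφ n).sub (hψ n), ?_, ?_⟩
  · filter_upwards [hφl, hψl] with x h1 h2 using h1.sub h2
  · have hlim : Tendsto (fun n => 2 * energy s (φ n - u) +
        2 * (ENNReal.ofReal ((-1) ^ 2) * energy s (ψ n - v))) atTop (𝓝 0) := by
      have h1 := ENNReal.Tendsto.const_mul (a := 2) hφE (Or.inr (by simp))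
      have h2 := ENNReal.Tendsto.const_mul (a := 2) (ENNReal.Tendsto.const_mul
        (a := ENNReal.ofReal ((-1) ^ 2)) hψE (Or.inr (by simp))) (Or.inr (by simp))
      simpa using h1.add h2
    refine tendsto_of_tendsto_of_tendsto_of_le_of_le tendsto_const_nhds hlim
      (fun _ => zero_le) fun n => ?_
    have := energy_add_le s (u := φ n - u) (v := fun x => -1 * (ψ n - v) x)
      (w := φ n - ψ n - (u - v)) ((hφ n).measurable.aemeasurable.sub hum)
      (((hψ n).measurable.aemeasurable.sub hvm).const_mul _) (fun x => by simp; ring)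
    rwa [energy_const_mul] at this

/-- Dominated convergence in `L²` with a dominating sequence that converges in `L²`. -/
theorem tendsto_lintegral_sq_of_dominated {α : Type*} [MeasurableSpace α] {μ : Measure α}
    {f a g : α → ℝ} {fn an : ℕ → α → ℝ} {C : ℝ} (hC : 0 ≤ C)
    (hfn : ∀ n, AEMeasurable (fn n) μ) (han : ∀ n, AEMeasurable (an n) μ)
    (hg : AEMeasurable g μ) (hg0 : ∀ x, 0 ≤ g x)
    (hdom : ∀ n x, |fn n x| ≤ C * |an n x| + g x)
    (hflim : ∀ᵐ x ∂μ, Tendsto (fun n => fn n x) atTop (𝓝 (f x)))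
    (halim : ∀ᵐ x ∂μ, Tendsto (fun n => an n x) atTop (𝓝 (a x)))
    (haL : Tendsto (fun n => ∫⁻ x, ENNReal.ofReal ((an n x - a x) ^ 2) ∂μ) atTop (𝓝 0))
    (ha2 : ∫⁻ x, ENNReal.ofReal (a x ^ 2) ∂μ < ⊤) (hg2 : ∫⁻ x, ENNReal.ofReal (g x ^ 2) ∂μ < ⊤) :
    Tendsto (fun n => ∫⁻ x, ENNReal.ofReal ((fn n x - f x) ^ 2) ∂μ) atTop (𝓝 0) := by
  have ha : AEMeasurable a μ := aemeasurable_of_tendsto_metrizable_ae atTop han halim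
  have hf : AEMeasurable f μ := aemeasurable_of_tendsto_metrizable_ae atTop hfn hflim
  set G : α → ℝ := fun x => C * |a x| + g x with hG
  have hGm : AEMeasurable G μ := by
    have : AEMeasurable (fun x => |a x|) μ := ha.abs
    fun_prop
  have hG0 : ∀ x, 0 ≤ G x := fun x => add_nonneg (by positivity) (hg0 x)
  have hG2 : ∫⁻ x, ENNReal.ofReal (G x ^ 2) ∂μ < ⊤ := by
    refine lt_of_le_of_lt (lintegral_sq_add_le (a := g) (b := fun x => C * |a x|) hg
      fun x => add_comm _ _) ?_
    have : ∫⁻ x, ENNReal.ofReal ((C * |a x|) ^ 2) ∂μ =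
        ENNReal.ofReal (C ^ 2) * ∫⁻ x, ENNReal.ofReal (a x ^ 2) ∂μ := by
      rw [← lintegral_const_mul' _ _ (by finiteness)]
      refine lintegral_congr fun x => ?_
      rw [← ENNReal.ofReal_mul (by positivity), mul_pow, sq_abs]
    rw [this]
    finiteness
  -- Clamping `fn n` to `[-G, G]`, with `G` the square-integrable limit of the dominating functions,
  -- makes ordinary dominated convergence available.
  set t : ℕ → α → ℝ := fun n x => max (-G x) (min (fn n x) (G x)) with ht
  have htm : ∀ n, AEMeasurable (t n) μ := fun n => hGm.neg.max ((hfn n).min hGm)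
  have hfG : ∀ᵐ x ∂μ, |f x| ≤ G x := by
    filter_upwards [hflim, halim] with x h1 h2
    exact le_of_tendsto_of_tendsto' h1.abs ((h2.abs.const_mul C).add_const (g x)) (hdom · x)
  have htlim : Tendsto (fun n => ∫⁻ x, ENNReal.ofReal ((t n x - f x) ^ 2) ∂μ) atTop (𝓝 0) := by
    have := tendsto_lintegral_of_dominated_convergence' (μ := μ)
      (F := fun n x => ENNReal.ofReal ((t n x - f x) ^ 2)) (f := fun _ => 0)
      (fun x => 4 * ENNReal.ofReal (G x ^ 2))
      (fun n => (((htm n).sub hf).pow_const 2).ennreal_ofReal)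
      (fun n => ?_) ?_ ?_
    · simpa using this
    · filter_upwards [hfG] with x hx
      rw [← ENNReal.ofReal_ofNat, ← ENNReal.ofReal_mul (by norm_num)]
      refine ENNReal.ofReal_le_ofReal ?_
      have h1 : |t n x| ≤ G x :=
        abs_le.2 ⟨le_max_left _ _, max_le (by linarith [hG0 x]) (min_le_right _ _)⟩
      have h2 : |t n x - f x| ≤ 2 * G x := (abs_sub _ _).trans (by linarith)
      rw [← sq_abs]
      nlinarith [abs_nonneg (t n x - f x)]
    · rw [lintegral_const_mul' _ _ (by simp)]
      finiteness
    · filter_upwards [hflim, hfG] with x h1 h2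
      have h3 : Tendsto (fun n => t n x) atTop (𝓝 (f x)) := by
        have : f x = max (-G x) (min (f x) (G x)) := by
          rw [min_eq_left (abs_le.1 h2).2, max_eq_right (abs_le.1 h2).1]
        rw [this]
        exact tendsto_const_nhds.max (h1.min tendsto_const_nhds)
      have h4 : Tendsto (fun n => (t n x - f x) ^ 2) atTop (𝓝 0) := by
        simpa using (h3.sub_const (f x)).pow 2
      simpa using ENNReal.tendsto_ofReal h4
  have hsum : Tendsto (fun n => 2 * (ENNReal.ofReal (C ^ 2) *
      ∫⁻ x, ENNReal.ofReal ((an n x - a x) ^ 2) ∂μ) +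
      2 * ∫⁻ x, ENNReal.ofReal ((t n x - f x) ^ 2) ∂μ) atTop (𝓝 0) := by
    have h1 := ENNReal.Tendsto.const_mul (a := 2) (ENNReal.Tendsto.const_mul
        (a := ENNReal.ofReal (C ^ 2)) haL (Or.inr (by simp))) (Or.inr (by simp))
    have h2 := ENNReal.Tendsto.const_mul (a := 2) htlim (Or.inr (by simp))
    simpa using h1.add h2
  refine tendsto_of_tendsto_of_tendsto_of_le_of_le tendsto_const_nhds hsum
    (fun _ => zero_le) fun n => ?_
  -- The part removed by clamping is at most `C * |an n - a|`, which tends to `0` in `L²` by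
  -- hypothesis.
  refine (lintegral_sq_add_le (a := fun x => fn n x - t n x) (b := fun x => t n x - f x)
    ((hfn n).sub (htm n)) fun x => by ring).trans ?_
  gcongr
  rw [← lintegral_const_mul' _ _ (by finiteness)]
  refine lintegral_mono fun x => ?_
  rw [← ENNReal.ofReal_mul (by positivity), ← mul_pow]
  refine ENNReal.ofReal_le_ofReal (sq_le_sq.2 ?_)
  rw [abs_mul, abs_of_nonneg hC]
  have h1 : |fn n x| ≤ C * |an n x - a x| + G x := by
    have h2 : |an n x| ≤ |an n x - a x| + |a x| := by
      simpa using abs_add_le (an n x - a x) (a x)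
    calc |fn n x| ≤ C * |an n x| + g x := hdom n x
      _ ≤ C * (|an n x - a x| + |a x|) + g x := by gcongr
      _ = _ := by simp only [hG]; ring
  have h0 : 0 ≤ C * |an n x - a x| := by positivity
  simp only [ht]
  obtain ⟨h2, h3⟩ := abs_le.1 h1
  have := hG0 x
  rcases le_total (fn n x) (G x) with h4 | h4
  · rw [min_eq_left h4]
    rcases le_total (-G x) (fn n x) with h5 | h5
    · rw [max_eq_right h5]; simpa using h0
    · rw [max_eq_left h5, abs_le]; constructor <;> linarith
  · rw [min_eq_right h4, max_eq_right (by linarith), abs_le]; constructor <;> linarith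

/-- Stability of `𝓓₀^{s,2}(U)` under superposition with dominated increments. -/
theorem MemD.of_dominated {N : ℕ} (hN : 1 ≤ N) {s : ℝ} (hs : s ∈ Set.Ioo (0 : ℝ) 1)
    {U : Set (Pt N)} {u f : Pt N → ℝ} {φ ψ : ℕ → Pt N → ℝ} {g : Pt N × Pt N → ℝ} {C : ℝ}
    (hC : 0 ≤ C) (hφ : ∀ n, IsTestFunction U (φ n))
    (hφl : ∀ᵐ x, Tendsto (fun n => φ n x) atTop (𝓝 (u x)))
    (hφE : Tendsto (fun n => energy s (φ n - u)) atTop (𝓝 0))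
    (hψ : ∀ n, IsTestFunction U (ψ n))
    (hψl : ∀ᵐ x, Tendsto (fun n => ψ n x) atTop (𝓝 (f x)))
    (hg : Measurable g) (hg0 : ∀ p, 0 ≤ g p)
    (hg2 : ∫⁻ p, ENNReal.ofReal (g p ^ 2) ∂pairMeasure N s < ⊤)
    (hdom : ∀ n x y, |ψ n x - ψ n y| ≤ C * |φ n x - φ n y| + g (x, y)) : MemD U s f := by
  have hu : MemD U s u := ⟨φ, hφ, hφl, hφE⟩
  have hum := hu.aemeasurable
  have hfm : AEMeasurable f :=
    aemeasurable_of_tendsto_metrizable_ae atTop (fun n => (hψ n).measurable.aemeasurable) hψl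
  refine ⟨ψ, hψ, hψl, ?_⟩
  have key := tendsto_lintegral_sq_of_dominated (μ := pairMeasure N s)
    (f := fun p => f p.1 - f p.2) (a := fun p => u p.1 - u p.2) (g := g)
    (fn := fun n p => ψ n p.1 - ψ n p.2) (an := fun n p => φ n p.1 - φ n p.2) hC
    (fun n => aemeasurable_pair_sub s (hψ n).measurable.aemeasurable)
    (fun n => aemeasurable_pair_sub s (hφ n).measurable.aemeasurable)
    hg.aemeasurable hg0 (fun n p => hdom n p.1 p.2) ?_ ?_ ?_ ?_ hg2
  · refine key.congr fun n => ?_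
    rw [energy_eq_lintegral s ((hψ n).measurable.aemeasurable.sub hfm)]
    refine lintegral_congr fun p => ?_
    simp only [Pi.sub_apply]
    congr 2
    ring
  · filter_upwards [ae_pairMeasure_fst s hψl, ae_pairMeasure_snd s hψl] with p h1 h2
      using h1.sub h2
  · filter_upwards [ae_pairMeasure_fst s hφl, ae_pairMeasure_snd s hφl] with p h1 h2
      using h1.sub h2
  · refine hφE.congr fun n => ?_
    rw [energy_eq_lintegral s ((hφ n).measurable.aemeasurable.sub hum)]
    refine lintegral_congr fun p => ?_
    simp only [Pi.sub_apply]
    congr 2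
    ring
  · rw [← energy_eq_lintegral s hum]
    exact hu.energy_lt_top hN hs

/-! ### The competitor `√(u² + φ²)` -/

/-- Reverse triangle inequality for the Euclidean norms of `(e, a, c)` and `(e, b, d)`. No constant
depends on `e`, which is sent to `0` later. -/
theorem abs_sqrt_sub_sqrt_le (e a b c d : ℝ) :
    |√(e ^ 2 + a ^ 2 + c ^ 2) - √(e ^ 2 + b ^ 2 + d ^ 2)| ≤ |a - b| + |c - d| := by
  have key : ∀ a b c d : ℝ, √(e ^ 2 + a ^ 2 + c ^ 2) ≤
      √(e ^ 2 + b ^ 2 + d ^ 2) + (|a - b| + |c - d|) := by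
    intro a b c d
    have hB0 := Real.sqrt_nonneg (e ^ 2 + b ^ 2 + d ^ 2)
    have hBsq := Real.sq_sqrt (show 0 ≤ e ^ 2 + b ^ 2 + d ^ 2 by positivity)
    have hb : |b| ≤ √(e ^ 2 + b ^ 2 + d ^ 2) := Real.abs_le_sqrt (by nlinarith)
    have hd : |d| ≤ √(e ^ 2 + b ^ 2 + d ^ 2) := Real.abs_le_sqrt (by nlinarith)
    set B := √(e ^ 2 + b ^ 2 + d ^ 2)
    refine Real.sqrt_le_iff.2 ⟨by positivity, ?_⟩
    have h1 : (a - b) * b ≤ |a - b| * B := (le_abs_self _).trans (by rw [abs_mul]; gcongr)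
    have h2 : (c - d) * d ≤ |c - d| * B := (le_abs_self _).trans (by rw [abs_mul]; gcongr)
    have h3 := sq_abs (a - b)
    have h4 := sq_abs (c - d)
    have h5 : 0 ≤ |a - b| * |c - d| := by positivity
    nlinarith
  refine abs_le.2 ⟨?_, by linarith [key a b c d]⟩
  have := key b a d c
  rw [abs_sub_comm b a, abs_sub_comm d c] at this
  linarith

/-- The approximants are `√(e² + ψ² + φ²) - e`: the term `e²` keeps the root smooth where `ψ` and
`φ` vanish, and subtracting `e` keeps the support compact in `U`. -/
theorem MemD.sqrt_sq_add_sq {N : ℕ} (hN : 1 ≤ N) {s : ℝ} (hs : s ∈ Set.Ioo (0 : ℝ) 1)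
    {U : Set (Pt N)} {u φ : Pt N → ℝ} (hu : MemD U s u) (hφ : IsTestFunction U φ) :
    MemD U s (fun x => √(u x ^ 2 + φ x ^ 2)) := by
  obtain ⟨ψ, hψ, hψl, hψE⟩ := hu
  set e : ℕ → ℝ := fun n => 1 / ((n : ℝ) + 1) with he
  have he0 : ∀ n, 0 < e n := fun n => by positivity
  have hel : Tendsto e atTop (𝓝 0) := tendsto_one_div_add_atTop_nhds_zero_nat
  refine MemD.of_dominated hN hs (C := 1) (φ := ψ) (u := u)
    (ψ := fun n x => √(e n ^ 2 + ψ n x ^ 2 + φ x ^ 2) - e n)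
    (g := fun p => |φ p.1 - φ p.2|) zero_le_one hψ hψl hψE (fun n => ?_) ?_ ?_
    (fun _ => abs_nonneg _) ?_ fun n x y => ?_
  · have hsub : Function.support (fun x => √(e n ^ 2 + ψ n x ^ 2 + φ x ^ 2) - e n) ⊆
        tsupport (ψ n) ∪ tsupport φ := by
      intro x hx
      by_contra hcon
      rw [Set.mem_union, not_or] at hcon
      refine hx ?_
      simp [image_eq_zero_of_notMem_tsupport hcon.1, image_eq_zero_of_notMem_tsupport hcon.2,
        Real.sqrt_sq (he0 n).le]
    have hcl : IsClosed (tsupport (ψ n) ∪ tsupport φ) :=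
      (isClosed_tsupport _).union (isClosed_tsupport _)
    refine ⟨?_, ?_, ?_⟩
    · refine ContDiff.sub (ContDiff.sqrt ?_ fun x => ?_) contDiff_const
      · exact (contDiff_const.add ((hψ n).1.pow 2)).add (hφ.1.pow 2)
      · have := he0 n
        positivity
    · exact HasCompactSupport.of_support_subset_isCompact ((hψ n).2.1.isCompact.union
        hφ.2.1.isCompact) hsub
    · exact (closure_minimal hsub hcl).trans (Set.union_subset (hψ n).2.2 hφ.2.2)
  · filter_upwards [hψl] with x hx
    have h1 : Tendsto (fun n => √(e n ^ 2 + ψ n x ^ 2 + φ x ^ 2) - e n) atTop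
        (𝓝 (√(0 ^ 2 + u x ^ 2 + φ x ^ 2) - 0)) :=
      ((((hel.pow 2).add (hx.pow 2)).add_const _).sqrt).sub hel
    simpa using h1
  · have := hφ.measurable
    fun_prop
  · simp only [sq_abs]
    rw [← energy_eq_lintegral s hφ.measurable.aemeasurable]
    exact hφ.energy_lt_top hN hs
  · rw [one_mul, sub_sub_sub_cancel_right]
    exact abs_sqrt_sub_sqrt_le _ _ _ _ _

/-! ### The competitor `u - (u - h)₊` -/

/-- A smooth approximation of the positive part. -/
noncomputable def smoothRamp (t : ℝ) : ℝ := ∫ x in (0 : ℝ)..t, Real.smoothTransition x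

theorem intervalIntegrable_smoothTransition (a b : ℝ) :
    IntervalIntegrable Real.smoothTransition volume a b :=
  Real.smoothTransition.continuous.intervalIntegrable a b

theorem contDiff_smoothRamp : ContDiff ℝ ∞ smoothRamp := by
  have hd : ∀ t, HasDerivAt smoothRamp (Real.smoothTransition t) t := fun t =>
    intervalIntegral.integral_hasDerivAt_right (intervalIntegrable_smoothTransition _ _)
      (Real.smoothTransition.continuous.stronglyMeasurableAtFilter _ _)
      Real.smoothTransition.continuous.continuousAt
  rw [contDiff_infty_iff_deriv]
  refine ⟨fun t => (hd t).differentiableAt, ?_⟩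
  rw [show deriv smoothRamp = Real.smoothTransition from funext fun t => (hd t).deriv]
  exact Real.smoothTransition.contDiff

theorem smoothRamp_of_nonpos {t : ℝ} (ht : t ≤ 0) : smoothRamp t = 0 := by
  unfold smoothRamp
  rw [intervalIntegral.integral_congr (g := fun _ => (0 : ℝ))]
  · simp
  · intro x hx
    rw [Set.uIcc_of_ge ht] at hx
    exact Real.smoothTransition.zero_of_nonpos hx.2

theorem abs_smoothRamp_sub_le (a b : ℝ) : |smoothRamp a - smoothRamp b| ≤ |a - b| := by
  unfold smoothRamp
  rw [intervalIntegral.integral_interval_sub_left (intervalIntegrable_smoothTransition _ _)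
    (intervalIntegrable_smoothTransition _ _)]
  have := intervalIntegral.norm_integral_le_of_norm_le_const (a := b) (b := a)
    (f := Real.smoothTransition) (C := 1) fun x _ => by
      rw [Real.norm_eq_abs, abs_of_nonneg (Real.smoothTransition.nonneg x)]
      exact Real.smoothTransition.le_one x
  simpa using this

/-- Under the rescaling `t ↦ e * smoothRamp (t / e)` the error `1` becomes `e`: these maps tend
uniformly to the positive part, remain `1`-Lipschitz and vanish for `t ≤ 0`. -/
theorem abs_smoothRamp_sub_max_le (t : ℝ) : |smoothRamp t - max t 0| ≤ 1 := by
  rcases le_total t 0 with h | h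
  · simp [smoothRamp_of_nonpos h, max_eq_right h]
  · rw [max_eq_left h]
    have h0 : smoothRamp 0 = 0 := smoothRamp_of_nonpos le_rfl
    have hle : smoothRamp t ≤ t := by
      have := abs_smoothRamp_sub_le t 0
      rw [h0, sub_zero, sub_zero, abs_of_nonneg h] at this
      exact (le_abs_self _).trans this
    have hge : t - 1 ≤ smoothRamp t := by
      rcases le_total t 1 with h1 | h1
      · have : 0 ≤ smoothRamp t := intervalIntegral.integral_nonneg h
          fun x _ => Real.smoothTransition.nonneg x
        linarith
      · have h2 : smoothRamp t = smoothRamp 1 + (t - 1) := by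
          unfold smoothRamp
          rw [← intervalIntegral.integral_add_adjacent_intervals
            (intervalIntegrable_smoothTransition 0 1) (intervalIntegrable_smoothTransition 1 t)]
          congr 1
          rw [intervalIntegral.integral_congr (g := fun _ => (1 : ℝ))]
          · simp
          · intro x hx
            rw [Set.uIcc_of_le h1] at hx
            exact Real.smoothTransition.one_of_one_le hx.1
        have h3 : 0 ≤ smoothRamp 1 := intervalIntegral.integral_nonneg zero_le_one
          fun x _ => Real.smoothTransition.nonneg x
        linarith
    rw [abs_le]
    constructor <;> linarith

/-- The truncation `(u - h)₊` of an element of `𝓓₀^{s,2}(U)` is the limit of test functions. -/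
theorem MemD.posPart_sub {N : ℕ} (hN : 1 ≤ N) {s : ℝ} (hs : s ∈ Set.Ioo (0 : ℝ) 1)
    {U : Set (Pt N)} (hU : MeasurableSet U) (hUfin : volume U < ⊤) {u h : Pt N → ℝ}
    (hu : MemD U s u) (hh : ContDiff ℝ ∞ h) (hpos : ∀ x, 0 < h x) {Γ : ℝ≥0∞} (hΓ : Γ ≠ ⊤)
    (hgrad : ∀ x, ∫⁻ y, ENNReal.ofReal ((h x - h y) ^ 2 / ‖x - y‖ ^ ((N : ℝ) + 2 * s)) ≤ Γ) :
    MemD U s (fun x => max (u x - h x) 0) := by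
  obtain ⟨φ, hφ, hφl, hφE⟩ := hu
  have hhm : Measurable h := hh.continuous.measurable
  set e : ℕ → ℝ := fun n => 1 / ((n : ℝ) + 1) with he
  have he0 : ∀ n, 0 < e n := fun n => by positivity
  have hel : Tendsto e atTop (𝓝 0) := tendsto_one_div_add_atTop_nhds_zero_nat
  -- `h` itself may have infinite energy. For pairs outside `D` both approximants vanish, so its
  -- increments matter only on `D`, where they are square integrable because `U` has finite measure.
  set D : Set (Pt N × Pt N) := {p | p.1 ∈ U ∨ p.2 ∈ U} with hD
  have hDm : MeasurableSet D := (measurable_fst hU).union (measurable_snd hU)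
  have hzero : ∀ n x, φ n x ≤ h x → e n * smoothRamp ((φ n x - h x) / e n) = 0 := fun n x hx => by
    rw [smoothRamp_of_nonpos (div_nonpos_of_nonpos_of_nonneg (by linarith) (he0 n).le), mul_zero]
  refine MemD.of_dominated hN hs (C := 1) (φ := φ) (u := u)
    (ψ := fun n x => e n * smoothRamp ((φ n x - h x) / e n))
    (g := D.indicator fun p => |h p.1 - h p.2|) zero_le_one hφ hφl hφE (fun n => ?_) ?_ ?_
    (fun _ => Set.indicator_nonneg (fun _ _ => abs_nonneg _) _) ?_ fun n x y => ?_
  · have hsub : Function.support (fun x => e n * smoothRamp ((φ n x - h x) / e n)) ⊆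
        tsupport (φ n) := by
      intro x hx
      by_contra hcon
      refine hx (hzero n x ?_)
      rw [image_eq_zero_of_notMem_tsupport hcon]
      exact (hpos x).le
    refine ⟨?_, ?_, ?_⟩
    · exact contDiff_const.mul (contDiff_smoothRamp.comp (((hφ n).1.sub hh).div_const _))
    · exact HasCompactSupport.of_support_subset_isCompact (hφ n).2.1.isCompact hsub
    · exact (closure_minimal hsub (isClosed_tsupport _)).trans (hφ n).2.2
  · filter_upwards [hφl] with x hx
    have h1 : Tendsto (fun n => max (φ n x - h x) 0) atTop (𝓝 (max (u x - h x) 0)) :=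
      (hx.sub_const _).max tendsto_const_nhds
    have h2 : Tendsto (fun n => e n * smoothRamp ((φ n x - h x) / e n) -
        max (φ n x - h x) 0) atTop (𝓝 0) := by
      refine squeeze_zero_norm (fun n => ?_) hel
      have h3 : e n * smoothRamp ((φ n x - h x) / e n) - max (φ n x - h x) 0 =
          e n * (smoothRamp ((φ n x - h x) / e n) - max ((φ n x - h x) / e n) 0) := by
        have h4 : max (φ n x - h x) 0 = e n * max ((φ n x - h x) / e n) 0 := by
          rw [mul_max_of_nonneg _ _ (he0 n).le, mul_div_cancel₀ _ (he0 n).ne', mul_zero]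
        rw [h4]
        ring
      rw [h3, Real.norm_eq_abs, abs_mul, abs_of_pos (he0 n)]
      exact mul_le_of_le_one_right (he0 n).le (abs_smoothRamp_sub_max_le _)
    simpa using h2.add h1
  · exact (Measurable.abs (by fun_prop)).indicator hDm
  · refine lt_of_le_of_lt (lintegral_mono fun p => ?_)
      (lt_of_le_of_lt (lintegral_indicator_or_le hhm hgrad hU) (by finiteness))
    by_cases hp : p.1 ∈ U ∨ p.2 ∈ U
    · rw [Set.indicator_of_mem (by exact hp), Set.indicator_of_mem (by exact hp), sq_abs]
    · rw [Set.indicator_of_notMem (by exact hp)]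
      simp
  · by_cases hp : x ∈ U ∨ y ∈ U
    · rw [Set.indicator_of_mem (by exact hp), ← mul_sub, abs_mul, abs_of_pos (he0 n)]
      calc e n * |smoothRamp ((φ n x - h x) / e n) - smoothRamp ((φ n y - h y) / e n)|
          ≤ e n * |(φ n x - h x) / e n - (φ n y - h y) / e n| :=
            mul_le_mul_of_nonneg_left (abs_smoothRamp_sub_le _ _) (he0 n).le
        _ = |(φ n x - h x) - (φ n y - h y)| := by
            rw [← sub_div, abs_div, abs_of_pos (he0 n), mul_div_cancel₀ _ (he0 n).ne']
        _ = |(φ n x - φ n y) - (h x - h y)| := by congr 1; ring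
        _ ≤ 1 * |φ n x - φ n y| + |h x - h y| := by rw [one_mul]; exact abs_sub _ _
    · rw [Set.indicator_of_notMem (by exact hp)]
      push Not at hp
      rw [hzero n x (by rw [(hφ n).eq_zero hp.1]; exact (hpos x).le),
        hzero n y (by rw [(hφ n).eq_zero hp.2]; exact (hpos y).le)]
      simp

/-! ### Densities, Poincaré and eigenvalue inequalities -/

theorem IsBoundedDensity.congr_ae {N : ℕ} {s q : ℝ} {U : Set (Pt N)} {u v : Pt N → ℝ}
    (h : IsBoundedDensity U s q u) (huv : u =ᵐ[volume] v) : IsBoundedDensity U s q v := by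
  obtain ⟨⟨hD, h0⟩, hmin⟩ := h
  refine ⟨⟨hD.congr_ae huv, ?_⟩, fun w hw hw0 => ?_⟩
  · filter_upwards [h0, ae_restrict_of_ae huv] with x h1 h2
    rwa [← h2]
  · have : freeEnergy U s q v = freeEnergy U s q u := by
      unfold freeEnergy
      rw [energy_congr_ae s huv, integral_congr_ae (g := fun x => u x ^ q)]
      filter_upwards [ae_restrict_of_ae huv] with x h2
      rw [h2]
    rw [this]
    exact hmin w hw hw0

/-- A density has a measurable non-negative representative vanishing outside the set. -/
theorem IsBoundedDensity.exists_representative {N : ℕ} {s q : ℝ} {U : Set (Pt N)}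
    (hU : MeasurableSet U) {u : Pt N → ℝ} (h : IsBoundedDensity U s q u) :
    ∃ v, u =ᵐ[volume] v ∧ Measurable v ∧ (∀ x, 0 ≤ v x) ∧ (∀ x, x ∉ U → v x = 0) ∧
      IsBoundedDensity U s q v := by
  have hm := h.1.1.aemeasurable
  have hae : u =ᵐ[volume] U.indicator fun x => max (hm.mk u x) 0 := by
    have h0 := h.1.2
    rw [ae_restrict_iff' hU] at h0
    filter_upwards [hm.ae_eq_mk, h0, h.1.1.ae_eq_zero] with x h1 h2 h3
    by_cases hx : x ∈ U
    · rw [Set.indicator_of_mem hx, ← h1, max_eq_left (h2 hx)]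
    · rw [Set.indicator_of_notMem hx, h3 hx]
  refine ⟨_, hae, (hm.measurable_mk.max measurable_const).indicator hU,
    fun x => Set.indicator_nonneg (fun _ _ => le_max_right _ _) x,
    fun x hx => Set.indicator_of_notMem hx _, h.congr_ae hae⟩

/-- Poincaré's inequality on sets of finite measure, in qualitative form. -/
theorem lintegral_sq_lt_top {N : ℕ} (hN : 1 ≤ N) {s : ℝ} (hs : 0 < s) {U : Set (Pt N)}
    (hUfin : volume U < ⊤) {u : Pt N → ℝ} (hu : Measurable u) (h0 : ∀ x, x ∉ U → u x = 0)
    (hE : energy s u < ⊤) : ∫⁻ x, ENNReal.ofReal (u x ^ 2) < ⊤ := by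
  have hω : volume (ball (0 : Pt N) 1) ≠ 0 := (measure_ball_pos _ _ one_pos).ne'
  have hωt : volume (ball (0 : Pt N) 1) ≠ ⊤ := measure_ball_lt_top.ne
  obtain ⟨r, hr1, hr⟩ : ∃ r : ℝ, 1 ≤ r ∧ 2 * volume U ≤ volume (ball (0 : Pt N) r) := by
    have hfin : 2 * volume U / volume (ball (0 : Pt N) 1) ≠ ⊤ := by
      refine ENNReal.div_ne_top (by finiteness) hω
    -- Taking `r ≥ 1` ensures `r ≤ r^N`, so no `N`-th root is needed.
    refine ⟨max 1 (2 * volume U / volume (ball (0 : Pt N) 1)).toReal, le_max_left _ _, ?_⟩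
    set r := max 1 (2 * volume U / volume (ball (0 : Pt N) 1)).toReal
    have hr1 : 1 ≤ r := le_max_left _ _
    rw [Measure.addHaar_ball_of_pos volume _ (by linarith), finrank_euclideanSpace_fin]
    have h1 : 2 * volume U / volume (ball (0 : Pt N) 1) ≤ ENNReal.ofReal (r ^ N) := by
      rw [← ENNReal.ofReal_toReal hfin]
      refine ENNReal.ofReal_le_ofReal ((le_max_right _ _).trans (le_self_pow₀ hr1 (by omega)))
    calc 2 * volume U = 2 * volume U / volume (ball (0 : Pt N) 1) * volume (ball (0 : Pt N) 1) :=
          (ENNReal.div_mul_cancel hω hωt).symm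
      _ ≤ _ := by gcongr
  have h1 := lintegral_sq_le_energy hs hu (r := r) (by linarith) (le_trans (by
    gcongr
    intro x hx
    by_contra hxU
    exact hx (h0 x hxU)) hr)
  have h2 : volume (ball (0 : Pt N) 1) * ∫⁻ x, ENNReal.ofReal (u x ^ 2) ≠ ⊤ := by
    refine ne_top_of_le_ne_top ?_ h1
    have := hE.ne
    finiteness
  exact lt_top_iff_ne_top.2 fun hcon => h2 (by rw [hcon, ENNReal.mul_top hω])

/-- The eigenvalue inequality extends from test functions to `𝓓₀^{s,2}(U)`. -/
theorem MemD.eigenvalue_le {N : ℕ} {s : ℝ} {U : Set (Pt N)} {l : ℝ≥0∞} (hlt : l ≠ ⊤)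
    (hl : ∀ φ : Pt N → ℝ, IsTestFunction U φ →
      l * ∫⁻ x, ENNReal.ofReal (φ x ^ 2) ≤ energy s φ)
    {u : Pt N → ℝ} (hu : MemD U s u) : l * ∫⁻ x, ENNReal.ofReal (u x ^ 2) ≤ 2 * energy s u := by
  have hum := hu.aemeasurable
  obtain ⟨φ, hφ, hφl, hφE⟩ := hu
  have hlim : Tendsto (fun n => 2 * energy s (φ n - u) + 2 * energy s u) atTop
      (𝓝 (2 * 0 + 2 * energy s u)) :=
    (ENNReal.Tendsto.const_mul hφE (Or.inr (by simp))).add tendsto_const_nhds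
  -- The crude `(a + b)² ≤ 2a² + 2b²` costs the factor `2` in the conclusion, which is absorbed in
  -- later constants.
  have hb : ∀ n, l * ∫⁻ x, ENNReal.ofReal (φ n x ^ 2) ≤
      2 * energy s (φ n - u) + 2 * energy s u := fun n =>
    (hl _ (hφ n)).trans (energy_add_le s ((hφ n).measurable.aemeasurable.sub hum) hum
      fun x => by simp)
  have hfatou : ∫⁻ x, l * ENNReal.ofReal (u x ^ 2) ≤
      liminf (fun n => ∫⁻ x, l * ENNReal.ofReal (φ n x ^ 2)) atTop := by
    refine le_trans (lintegral_mono_ae ?_) (lintegral_liminf_le' fun n =>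
      ((hφ n).measurable.pow_const 2).ennreal_ofReal.aemeasurable.const_mul l)
    filter_upwards [hφl] with x hx
    exact (ENNReal.Tendsto.const_mul (ENNReal.tendsto_ofReal (hx.pow 2))
      (Or.inr hlt)).liminf_eq.ge
  simp only [lintegral_const_mul' _ _ hlt] at hfatou
  refine hfatou.trans ((liminf_le_liminf (Eventually.of_forall hb)).trans ?_)
  rw [hlim.liminf_eq]
  simp

/-! ### Power inequalities and minimality -/

/-- Convexity of the power, as the tangent line at `a`: Bernoulli's inequality at `b / a`. -/
theorem rpow_sub_rpow_le {q a b : ℝ} (hq : 1 ≤ q) (hb : 0 ≤ b) (hba : b ≤ a) :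
    a ^ q - b ^ q ≤ q * (a ^ (q - 1) * (a - b)) := by
  rcases (hb.trans hba).eq_or_lt with ha | ha
  · have : b = 0 := le_antisymm (ha ▸ hba) hb
    simp [← ha, this]
  · have h1 := one_add_mul_self_le_rpow_one_add (s := b / a - 1)
      (by have := div_nonneg hb ha.le; linarith) hq
    rw [add_sub_cancel, Real.div_rpow hb ha.le, le_div_iff₀ (by positivity)] at h1
    have h2 : a ^ q = a ^ (q - 1) * a := by
      rw [← Real.rpow_add_one ha.ne', sub_add_cancel]
    have h3 : (1 + q * (b / a - 1)) * a ^ q = a ^ q - q * (a ^ (q - 1) * (a - b)) := by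
      rw [h2]
      field_simp
      ring
    linarith

/-- The concave counterpart, needed for `p = q / 2`. The tangent is taken at the larger point `a`,
since `b` may be `0`, where the slope would be infinite. -/
theorem mul_rpow_mul_sub_le {p a b : ℝ} (hp0 : 0 ≤ p) (hp : p ≤ 1) (hb : 0 ≤ b) (hba : b ≤ a) :
    p * (a ^ (p - 1) * (a - b)) ≤ a ^ p - b ^ p := by
  rcases (hb.trans hba).eq_or_lt with ha | ha
  · have : b = 0 := le_antisymm (ha ▸ hba) hb
    simp [← ha, this]
  · have h1 := rpow_one_add_le_one_add_mul_self (s := b / a - 1)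
      (by have := div_nonneg hb ha.le; linarith) hp0 hp
    rw [add_sub_cancel, Real.div_rpow hb ha.le, div_le_iff₀ (by positivity)] at h1
    have h2 : a ^ p = a ^ (p - 1) * a := by
      rw [← Real.rpow_add_one ha.ne', sub_add_cancel]
    have h3 : (1 + p * (b / a - 1)) * a ^ p = a ^ p - p * (a ^ (p - 1) * (a - b)) := by
      rw [h2]
      field_simp
      ring
    linarith

theorem rpow_le_one_add_sq {q a : ℝ} (hq0 : 0 ≤ q) (hq : q ≤ 2) (ha : 0 ≤ a) :
    a ^ q ≤ 1 + a ^ 2 := by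
  rcases le_total a 1 with h | h
  · have := Real.rpow_le_one ha h hq0
    nlinarith
  · have := Real.rpow_le_rpow_of_exponent_le h hq
    rw [Real.rpow_two] at this
    linarith

theorem integrableOn_rpow {N : ℕ} (hN : 1 ≤ N) {s q : ℝ} (hs : 0 < s)
    (hq : q ∈ Set.Ioo (1 : ℝ) 2) {U : Set (Pt N)} (hUfin : volume U < ⊤) {u : Pt N → ℝ}
    (hu : Measurable u) (hu0 : ∀ x, 0 ≤ u x) (huU : ∀ x, x ∉ U → u x = 0)
    (hE : energy s u < ⊤) : IntegrableOn (fun x => u x ^ q) U := by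
  have h2 := lintegral_sq_lt_top hN hs hUfin hu huU hE
  have hi : Integrable (fun x => u x ^ 2) := by
    refine ⟨(hu.pow_const 2).aestronglyMeasurable, ?_⟩
    rw [hasFiniteIntegral_iff_ofReal (ae_of_all _ fun x => sq_nonneg _)]
    exact h2
  have hc : IntegrableOn (fun _ : Pt N => (1 : ℝ)) U := integrableOn_const hUfin.ne
  refine Integrable.mono' (hc.add hi.integrableOn) (hu.pow_const q).aestronglyMeasurable
    (ae_of_all _ fun x => ?_)
  rw [Real.norm_eq_abs, abs_of_nonneg (Real.rpow_nonneg (hu0 x) q)]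
  exact rpow_le_one_add_sq (by linarith [hq.1]) hq.2.le (hu0 x)

/-- Minimality of a density, with the integrals of the powers combined. -/
theorem IsBoundedDensity.energy_le {N : ℕ} (hN : 1 ≤ N) {s q : ℝ} (hs : s ∈ Set.Ioo (0 : ℝ) 1)
    (hq : q ∈ Set.Ioo (1 : ℝ) 2) {U : Set (Pt N)} (hUfin : volume U < ⊤) {u v : Pt N → ℝ}
    (h : IsBoundedDensity U s q u) (hu : Measurable u) (hu0 : ∀ x, 0 ≤ u x)
    (huU : ∀ x, x ∉ U → u x = 0) (hvD : MemD U s v) (hv : Measurable v) (hv0 : ∀ x, 0 ≤ v x)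
    (hvU : ∀ x, x ∉ U → v x = 0) :
    IntegrableOn (fun x => v x ^ q - u x ^ q) U ∧
    (energy s u).toReal + 2 / q * ∫ x in U, (v x ^ q - u x ^ q) ≤ (energy s v).toReal := by
  have h1 := integrableOn_rpow hN hs.1 hq hUfin hu hu0 huU (h.1.1.energy_lt_top hN hs)
  have h2 := integrableOn_rpow hN hs.1 hq hUfin hv hv0 hvU (hvD.energy_lt_top hN hs)
  refine ⟨h2.sub h1, ?_⟩
  rw [integral_sub h2 h1]
  have := h.2 v hvD (ae_of_all _ hv0)
  unfold freeEnergy at this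
  have e : 2 / q = 2 * (1 / q) := by ring
  rw [e]
  linarith

/-! ### Energy of truncations above a varying level -/

/-- Let `Z` be the increment of the truncations. Monotonicity of the positive part gives `Z² ≤ ((a -
b) - (c - d)) Z`, and the cross term `(c - d) Z` is absorbed by completing a square. -/
theorem sq_truncation_add_le (a b c d : ℝ) :
    ((a - max (a - c) 0) - (b - max (b - d) 0)) ^ 2 +
      1 / 2 * (max (a - c) 0 - max (b - d) 0) ^ 2 ≤ (a - b) ^ 2 + 2 * (c - d) ^ 2 := by
  have key : (max (a - c) 0 - max (b - d) 0) ^ 2 ≤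
      ((a - c) - (b - d)) * (max (a - c) 0 - max (b - d) 0) := by
    rcases max_cases (a - c) 0 with ⟨e1, h1⟩ | ⟨e1, h1⟩ <;>
    rcases max_cases (b - d) 0 with ⟨e2, h2⟩ | ⟨e2, h2⟩ <;> rw [e1, e2] <;> nlinarith
  nlinarith [sq_nonneg (max (a - c) 0 - max (b - d) 0 + 2 * (c - d))]

/-- Where both points lie outside `{h < u}` the truncations vanish and nothing is lost, so the
increments of `h` are charged only to pairs meeting that set. -/
theorem energy_truncation_add_le {N : ℕ} {s : ℝ} {u h : Pt N → ℝ} (hu : Measurable u)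
    (hh : Measurable h) {Γ : ℝ≥0∞}
    (hgrad : ∀ x, ∫⁻ y, ENNReal.ofReal ((h x - h y) ^ 2 / ‖x - y‖ ^ ((N : ℝ) + 2 * s)) ≤ Γ) :
    energy s (fun x => u x - max (u x - h x) 0) + 2⁻¹ * energy s (fun x => max (u x - h x) 0) ≤
      energy s u + 4 * Γ * volume {x | h x < u x} := by
  set A := {x | h x < u x} with hA
  have hAm : MeasurableSet A := measurableSet_lt hh hu
  have hz : Measurable fun x => max (u x - h x) 0 := by fun_prop
  have hlow := lintegral_indicator_or_le (s := s) hh hgrad hAm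
  set D : Set (Pt N × Pt N) := {p | p.1 ∈ A ∨ p.2 ∈ A} with hD
  have hDm : MeasurableSet D := (measurable_fst hAm).union (measurable_snd hAm)
  have hv : Measurable fun x => u x - max (u x - h x) 0 := hu.sub hz
  rw [energy_eq_lintegral s hv.aemeasurable, energy_eq_lintegral s hz.aemeasurable,
    energy_eq_lintegral s hu.aemeasurable]
  calc _ = ∫⁻ p, (ENNReal.ofReal (((u p.1 - max (u p.1 - h p.1) 0) -
          (u p.2 - max (u p.2 - h p.2) 0)) ^ 2) +
          2⁻¹ * ENNReal.ofReal ((max (u p.1 - h p.1) 0 - max (u p.2 - h p.2) 0) ^ 2))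
          ∂pairMeasure N s := by
        rw [lintegral_add_left (by fun_prop), lintegral_const_mul' _ _ (by simp)]
    _ ≤ ∫⁻ p, (ENNReal.ofReal ((u p.1 - u p.2) ^ 2) +
          2 * D.indicator (fun p => ENNReal.ofReal ((h p.1 - h p.2) ^ 2)) p)
          ∂pairMeasure N s := by
        refine lintegral_mono fun p => ?_
        by_cases hp : p.1 ∈ A ∨ p.2 ∈ A
        · rw [Set.indicator_of_mem (by exact hp)]
          have e : (2⁻¹ : ℝ≥0∞) = ENNReal.ofReal (1 / 2) := by
            rw [one_div, ENNReal.ofReal_inv_of_pos (by norm_num), ENNReal.ofReal_ofNat]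
          rw [e, ← ENNReal.ofReal_ofNat 2, ← ENNReal.ofReal_mul (by norm_num),
            ← ENNReal.ofReal_mul (by norm_num), ← ENNReal.ofReal_add (by positivity)
            (by positivity), ← ENNReal.ofReal_add (by positivity) (by positivity)]
          exact ENNReal.ofReal_le_ofReal (sq_truncation_add_le _ _ _ _)
        · rw [Set.indicator_of_notMem (by exact hp)]
          simp only [hA, Set.mem_ofPred_eq, not_or, not_lt] at hp
          rw [max_eq_right (by linarith [hp.1]), max_eq_right (by linarith [hp.2])]
          simp
    _ = _ := by
        rw [lintegral_add_left (by fun_prop), lintegral_const_mul' _ _ (by simp)]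
    _ ≤ _ := (add_le_add le_rfl (mul_le_mul' le_rfl hlow)).trans (le_of_eq (by ring))

/-- Energy estimate for the truncations of a density above a varying level. -/
theorem IsBoundedDensity.energy_posPart_le {N : ℕ} (hN : 1 ≤ N) {s q : ℝ}
    (hs : s ∈ Set.Ioo (0 : ℝ) 1) (hq : q ∈ Set.Ioo (1 : ℝ) 2) {U : Set (Pt N)}
    (hUm : MeasurableSet U) (hUfin : volume U < ⊤) {u h : Pt N → ℝ}
    (hd : IsBoundedDensity U s q u) (hu : Measurable u) (hu0 : ∀ x, 0 ≤ u x)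
    (huU : ∀ x, x ∉ U → u x = 0) (hh : ContDiff ℝ ∞ h) (hpos : ∀ x, 0 < h x) {Γ : ℝ}
    (hΓ : 0 ≤ Γ) (hgrad : ∀ x, ∫⁻ y, ENNReal.ofReal
      ((h x - h y) ^ 2 / ‖x - y‖ ^ ((N : ℝ) + 2 * s)) ≤ ENNReal.ofReal Γ) :
    energy s (fun x => max (u x - h x) 0) ≤ ∫⁻ x, {x | h x < u x}.indicator
      (fun x => ENNReal.ofReal (4 * (u x ^ (q - 1) * max (u x - h x) 0) + 8 * Γ)) x := by
  have hhm : Measurable h := hh.continuous.measurable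
  set A := {x | h x < u x} with hA
  have hAm : MeasurableSet A := measurableSet_lt hhm hu
  have hAU : A ⊆ U := fun x hx => by
    by_contra hxU
    have h1 : h x < u x := hx
    rw [huU x hxU] at h1
    exact absurd h1 (hpos x).le.not_gt
  have hAfin : volume A < ⊤ := (measure_mono hAU).trans_lt hUfin
  set z : Pt N → ℝ := fun x => max (u x - h x) 0 with hz
  have hzm : Measurable z := by fun_prop
  have hz0 : ∀ x, 0 ≤ z x := fun x => le_max_right _ _
  have hzA : ∀ x, x ∉ A → z x = 0 := fun x hx => by
    simp only [hA, Set.mem_ofPred_eq, not_lt] at hx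
    exact max_eq_right (by linarith)
  have hzu : ∀ x, z x ≤ u x := fun x => max_le (by linarith [hpos x]) (hu0 x)
  have hzD : MemD U s z := hd.1.1.posPart_sub hN hs hUm hUfin hh hpos ENNReal.ofReal_ne_top hgrad
  have hvD : MemD U s (fun x => u x - z x) := hd.1.1.sub hzD
  have hEz := hzD.energy_lt_top hN hs
  have hEv := hvD.energy_lt_top hN hs
  have hEu := hd.1.1.energy_lt_top hN hs
  -- The competitor is `u - z = min u h`. Combined with `htr`, minimality leaves half the energy of
  -- `z` on the left.
  obtain ⟨hint, hmin⟩ := hd.energy_le hN hs hq hUfin hu hu0 huU hvD (hu.sub hzm)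
    (fun x => sub_nonneg.2 (hzu x)) (fun x hx => by
      rw [huU x hx, hzA x fun hxA => hx (hAU hxA), sub_zero])
  have htr := energy_truncation_add_le hu hhm hgrad
  have htr2 := ENNReal.toReal_mono (by finiteness) htr
  rw [ENNReal.toReal_add (by finiteness) (by finiteness),
    ENNReal.toReal_add (by finiteness) (by finiteness), ENNReal.toReal_mul, ENNReal.toReal_mul,
    ENNReal.toReal_mul, ENNReal.toReal_ofReal hΓ, ENNReal.toReal_inv, ENNReal.toReal_ofNat,
    ENNReal.toReal_ofNat] at htr2
  have hpow : ∀ x, u x ^ q - (u x - z x) ^ q ≤ q * (u x ^ (q - 1) * z x) := fun x => by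
    have := rpow_sub_rpow_le hq.1.le (sub_nonneg.2 (hzu x)) (sub_le_self (u x) (hz0 x))
    rwa [sub_sub_cancel] at this
  have hI1 : IntegrableOn (fun x => u x ^ (q - 1) * z x) U := by
    refine Integrable.mono' (integrableOn_rpow hN hs.1 hq hUfin hu hu0 huU hEu)
      (by fun_prop) (ae_of_all _ fun x => ?_)
    have h1 : 0 ≤ u x ^ (q - 1) := Real.rpow_nonneg (hu0 x) _
    rw [Real.norm_eq_abs, abs_of_nonneg (mul_nonneg h1 (hz0 x))]
    rcases (hu0 x).eq_or_lt with h2 | h2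
    · have : z x = 0 := le_antisymm (h2 ▸ hzu x) (hz0 x)
      rw [this, mul_zero]
      exact Real.rpow_nonneg (hu0 x) _
    · calc u x ^ (q - 1) * z x ≤ u x ^ (q - 1) * u x := by gcongr; exact hzu x
        _ = u x ^ q := by rw [← Real.rpow_add_one h2.ne', sub_add_cancel]
  have hI2 : -∫ x in U, ((u x - z x) ^ q - u x ^ q) ≤ q * ∫ x in U, u x ^ (q - 1) * z x := by
    rw [← integral_neg, ← integral_const_mul]
    refine integral_mono hint.neg (hI1.const_mul q) fun x => ?_
    simp only [neg_sub]
    exact hpow x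
  have hq0 : 0 < q := by linarith [hq.1]
  have hI3 : -(2 / q * ∫ x in U, ((u x - z x) ^ q - u x ^ q)) ≤
      2 * ∫ x in U, u x ^ (q - 1) * z x := by
    calc _ = 2 / q * -∫ x in U, ((u x - z x) ^ q - u x ^ q) := by ring
      _ ≤ 2 / q * (q * ∫ x in U, u x ^ (q - 1) * z x) := by gcongr
      _ = _ := by field_simp
  have hfin : (energy s z).toReal ≤
      4 * (∫ x in U, u x ^ (q - 1) * z x) + 8 * Γ * (volume A).toReal := by
    linarith
  have hg0 : ∀ x, 0 ≤ u x ^ (q - 1) * z x := fun x =>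
    mul_nonneg (Real.rpow_nonneg (hu0 x) _) (hz0 x)
  calc energy s z = ENNReal.ofReal (energy s z).toReal := (ENNReal.ofReal_toReal hEz.ne).symm
    _ ≤ ENNReal.ofReal (4 * (∫ x in U, u x ^ (q - 1) * z x) + 8 * Γ * (volume A).toReal) :=
      ENNReal.ofReal_le_ofReal hfin
    _ = ENNReal.ofReal (∫ x in U, 4 * (u x ^ (q - 1) * z x)) + ENNReal.ofReal (8 * Γ) * volume A := by
      rw [integral_const_mul, ENNReal.ofReal_add (mul_nonneg (by norm_num)
        (integral_nonneg hg0)) (by positivity), ENNReal.ofReal_mul (by positivity : 0 ≤ 8 * Γ),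
        ENNReal.ofReal_toReal hAfin.ne]
    _ = (∫⁻ x in U, ENNReal.ofReal (4 * (u x ^ (q - 1) * z x))) + ENNReal.ofReal (8 * Γ) * volume A := by
      rw [ofReal_integral_eq_lintegral_ofReal (hI1.const_mul 4)
        (ae_of_all _ fun x => mul_nonneg (by norm_num) (hg0 x))]
    _ ≤ (∫⁻ x, A.indicator (fun x => ENNReal.ofReal (4 * (u x ^ (q - 1) * z x))) x) +
        ∫⁻ x, A.indicator (fun _ => ENNReal.ofReal (8 * Γ)) x := by
      rw [lintegral_indicator_const hAm]
      refine add_le_add_left ?_ _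
      refine (setLIntegral_le_lintegral _ _).trans (lintegral_mono fun x => ?_)
      by_cases hx : x ∈ A
      · rw [Set.indicator_of_mem hx]
      · simp [hzA x hx]
    _ = ∫⁻ x, A.indicator (fun x => ENNReal.ofReal (4 * (u x ^ (q - 1) * z x) + 8 * Γ)) x := by
      rw [← lintegral_add_left (Measurable.indicator (by fun_prop) hAm)]
      refine lintegral_congr fun x => ?_
      by_cases hx : x ∈ A
      · simp only [Set.indicator_of_mem hx]
        rw [ENNReal.ofReal_add (mul_nonneg (by norm_num) (hg0 x)) (by positivity)]
      · simp [Set.indicator_of_notMem hx]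

/-! ### Hidden convexity -/

/-- Pointwise on pairs, this is the reverse triangle inequality for the planar vectors `(u, φ)`,
that is, Cauchy–Schwarz. -/
theorem energy_sqrt_sq_add_sq_le {N : ℕ} (s : ℝ) {u φ : Pt N → ℝ} (hu : Measurable u)
    (hφ : Measurable φ) :
    energy s (fun x => √(u x ^ 2 + φ x ^ 2)) ≤ energy s u + energy s φ := by
  have hm : Measurable fun x => √(u x ^ 2 + φ x ^ 2) := by fun_prop
  rw [energy_eq_lintegral s hm.aemeasurable, energy_eq_lintegral s hu.aemeasurable,
    energy_eq_lintegral s hφ.aemeasurable, ← lintegral_add_left (by fun_prop)]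
  refine lintegral_mono fun p => ?_
  rw [← ENNReal.ofReal_add (by positivity) (by positivity)]
  refine ENNReal.ofReal_le_ofReal ?_
  have h1 := Real.sq_sqrt (show 0 ≤ u p.1 ^ 2 + φ p.1 ^ 2 by positivity)
  have h2 := Real.sq_sqrt (show 0 ≤ u p.2 ^ 2 + φ p.2 ^ 2 by positivity)
  have h3 : u p.1 * u p.2 + φ p.1 * φ p.2 ≤
      √(u p.1 ^ 2 + φ p.1 ^ 2) * √(u p.2 ^ 2 + φ p.2 ^ 2) := by
    rw [← Real.sqrt_mul (by positivity)]
    refine Real.le_sqrt_of_sq_le ?_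
    nlinarith [sq_nonneg (u p.1 * φ p.2 - u p.2 * φ p.1)]
  nlinarith

/-- Hidden convexity: comparison of a density `u` with `√(u² + t φ²)`. -/
theorem IsBoundedDensity.lintegral_sq_mul_rpow_le {N : ℕ} (hN : 1 ≤ N) {s q : ℝ}
    (hs : s ∈ Set.Ioo (0 : ℝ) 1) (hq : q ∈ Set.Ioo (1 : ℝ) 2) {U : Set (Pt N)}
    (hUfin : volume U < ⊤) {u φ : Pt N → ℝ}
    (hd : IsBoundedDensity U s q u) (hu : Measurable u) (hu0 : ∀ x, 0 ≤ u x)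
    (huU : ∀ x, x ∉ U → u x = 0) (hφ : IsTestFunction U φ) {t : ℝ} (ht : 0 < t) :
    ∫⁻ x, ENNReal.ofReal (φ x ^ 2 * (u x ^ 2 + t * φ x ^ 2) ^ (q / 2 - 1)) ≤ energy s φ := by
  have hφm := hφ.measurable
  have hφt := hφ.const_mul √t
  have hsq : ∀ x, (√t * φ x) ^ 2 = t * φ x ^ 2 := fun x => by rw [mul_pow, Real.sq_sqrt ht.le]
  have hvD := hd.1.1.sqrt_sq_add_sq hN hs hφt
  have hEφ := hφ.energy_lt_top hN hs
  have hEu := hd.1.1.energy_lt_top hN hs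
  have hle := energy_sqrt_sq_add_sq_le s hu hφt.measurable
  rw [energy_const_mul, Real.sq_sqrt ht.le] at hle
  have hle2 := ENNReal.toReal_mono (by finiteness) hle
  rw [ENNReal.toReal_add (by finiteness) (by finiteness), ENNReal.toReal_mul,
    ENNReal.toReal_ofReal ht.le] at hle2
  obtain ⟨hint, hmin⟩ := hd.energy_le hN hs hq hUfin hu hu0 huU hvD (by fun_prop)
    (fun x => Real.sqrt_nonneg _) (fun x hx => by rw [huU x hx, hφ.eq_zero hx]; simp)
  simp only [hsq] at hint hmin hle2
  have hq0 : 0 < q := by linarith [hq.1]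
  set F : Pt N → ℝ := fun x => φ x ^ 2 * (u x ^ 2 + t * φ x ^ 2) ^ (q / 2 - 1) with hF
  have hF0 : ∀ x, 0 ≤ F x := fun x => by positivity
  -- Concavity of `a ↦ a^(q/2)`, with the tangent at `u² + t φ²`, which is positive wherever `φ ≠
  -- 0`.
  have hpt : ∀ x, q / 2 * t * F x ≤ √(u x ^ 2 + t * φ x ^ 2) ^ q - u x ^ q := fun x => by
    have h1 := mul_rpow_mul_sub_le (p := q / 2) (a := u x ^ 2 + t * φ x ^ 2) (b := u x ^ 2)
      (by linarith) (by linarith [hq.2]) (by positivity)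
      (le_add_of_nonneg_right (by positivity))
    have h2 : (u x ^ 2) ^ (q / 2) = u x ^ q := by
      rw [← Real.rpow_natCast, ← Real.rpow_mul (hu0 x)]
      congr 1
      push_cast
      ring
    have h3 : √(u x ^ 2 + t * φ x ^ 2) ^ q = (u x ^ 2 + t * φ x ^ 2) ^ (q / 2) := by
      rw [Real.sqrt_eq_rpow, ← Real.rpow_mul (by positivity)]
      congr 1
      ring
    rw [h2, ← h3] at h1
    refine le_trans (le_of_eq ?_) h1
    rw [hF, add_sub_cancel_left]
    ring
  have hFm : Measurable F := by fun_prop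
  have hFi : IntegrableOn (fun x => q / 2 * t * F x) U := by
    refine Integrable.mono' hint (by fun_prop) (ae_of_all _ fun x => ?_)
    rw [Real.norm_eq_abs, abs_of_nonneg (mul_nonneg (by positivity) (hF0 x))]
    exact hpt x
  have hFi' : IntegrableOn F U := by
    have := hFi.const_mul (q / 2 * t)⁻¹
    refine this.congr (ae_of_all _ fun x => ?_)
    simp only
    field_simp
  have hI := integral_mono hFi hint hpt
  rw [integral_const_mul] at hI
  have hI2 : ∫ x in U, F x ≤ (energy s φ).toReal := by
    have h1 : 2 / q * (q / 2 * t * ∫ x in U, F x) ≤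
        2 / q * ∫ x in U, (√(u x ^ 2 + t * φ x ^ 2) ^ q - u x ^ q) := by gcongr
    have h2 : 2 / q * (q / 2 * t * ∫ x in U, F x) = t * ∫ x in U, F x := by field_simp
    exact le_of_mul_le_mul_left (by linarith) ht
  calc ∫⁻ x, ENNReal.ofReal (F x) = ∫⁻ x in U, ENNReal.ofReal (F x) := by
        refine (setLIntegral_eq_of_support_subset ?_).symm
        intro x hx
        by_contra hxU
        exact hx (by simp [hF, hφ.eq_zero hxU])
    _ = ENNReal.ofReal (∫ x in U, F x) :=
        (ofReal_integral_eq_lintegral_ofReal hFi' (ae_of_all _ hF0)).symm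
    _ ≤ ENNReal.ofReal (energy s φ).toReal := ENNReal.ofReal_le_ofReal hI2
    _ = energy s φ := ENNReal.ofReal_toReal hEφ.ne

/-! ### The De Giorgi iteration -/

/-- The volume of the unit ball of `ℝ^N`. -/
noncomputable def unitVolume (N : ℕ) : ℝ := (volume (ball (0 : Pt N) 1)).toReal

theorem unitVolume_pos (N : ℕ) : 0 < unitVolume N :=
  ENNReal.toReal_pos (measure_ball_pos _ _ one_pos).ne' measure_ball_lt_top.ne

theorem volume_ball_eq {N : ℕ} (x : Pt N) {r : ℝ} (hr : 0 < r) :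
    volume (ball x r) = ENNReal.ofReal (unitVolume N * r ^ N) := by
  rw [Measure.addHaar_ball_of_pos volume _ hr, finrank_euclideanSpace_fin, unitVolume, mul_comm,
    ENNReal.ofReal_mul ENNReal.toReal_nonneg, ENNReal.ofReal_toReal measure_ball_lt_top.ne]

theorem lintegral_gradient_const_mul_le {N : ℕ} {s : ℝ} {H : Pt N → ℝ} {μ : ℝ}
    (hgrad : ∀ x, ∫⁻ y, ENNReal.ofReal ((H x - H y) ^ 2 / ‖x - y‖ ^ ((N : ℝ) + 2 * s)) ≤
      ENNReal.ofReal μ) (k : ℝ) (x : Pt N) :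
    ∫⁻ y, ENNReal.ofReal ((k * H x - k * H y) ^ 2 / ‖x - y‖ ^ ((N : ℝ) + 2 * s)) ≤
      ENNReal.ofReal (k ^ 2 * μ) := by
  rw [ENNReal.ofReal_mul (by positivity)]
  refine le_trans (le_of_eq ?_) (mul_le_mul' le_rfl (hgrad x))
  rw [← lintegral_const_mul' _ _ (by finiteness)]
  refine lintegral_congr fun y => ?_
  rw [← ENNReal.ofReal_mul (by positivity)]
  congr 1
  ring

/-- The contraction factor of the De Giorgi iteration. -/
noncomputable def contraction (N : ℕ) (s : ℝ) : ℝ := ((1 / 4 : ℝ) ^ (1 / (2 * s))) ^ N / 4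

theorem contraction_pos (N : ℕ) (s : ℝ) : 0 < contraction N s := by
  unfold contraction; positivity

theorem contraction_lt_one (N : ℕ) {s : ℝ} (hs : 0 < s) : contraction N s < 1 := by
  unfold contraction
  have h1 : ((1 / 4 : ℝ) ^ (1 / (2 * s))) ≤ 1 :=
    Real.rpow_le_one (by norm_num) (by norm_num) (by positivity)
  have h2 := pow_le_one₀ (n := N) (by positivity) h1
  linarith

/-- With `b = 2^j` the two levels are `k (j+1)` and `k j` times `H`. Above the higher one, `z = u -
k j * H` is at least `K H / (2b)`, so `u ≤ 5 b z` and `K H ≤ 2 b z`: both terms become multiples of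
`b² μ z²`. The constant is `148 = 4 * 5 + 8 * 16`. -/
theorem level_step {q u H K μ b : ℝ} (hq : q ∈ Set.Ioo (1 : ℝ) 2) (hK : 0 < K)
    (hKμ : K ^ (q - 2) ≤ μ) (hH : 1 ≤ H) (hb : 1 ≤ b) (hu : K * (2 - 1 / (2 * b)) * H < u) :
    4 * (u ^ (q - 1) * max (u - K * (2 - 1 / (2 * b)) * H) 0) +
      8 * ((K * (2 - 1 / (2 * b))) ^ 2 * μ) ≤
      148 * b ^ 2 * μ * max (u - K * (2 - 1 / b) * H) 0 ^ 2 := by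
  have hb0 : 0 < b := by linarith
  set c := 1 / (2 * b) with hc
  have hc0 : 0 < c := by positivity
  have hc1 : c ≤ 1 / 2 := by
    rw [hc, div_le_div_iff₀ (by positivity) (by norm_num)]
    linarith
  have hcb : 2 * b * c = 1 := by rw [hc]; field_simp
  have hcc : 1 / b = 2 * c := by rw [hc]; field_simp
  rw [hcc]
  have hKH : K ≤ K * H := by nlinarith
  have hKH0 : 0 < K * H := by positivity
  have hu0 : K < u := by nlinarith
  have hupos : 0 < u := by linarith
  have hμ : 0 < μ := lt_of_lt_of_le (by positivity) hKμ
  set z := u - K * (2 - 2 * c) * H with hz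
  have hz1 : K * H * c ≤ z := by rw [hz]; nlinarith
  have hz0 : 0 < z := lt_of_lt_of_le (by positivity) hz1
  rw [max_eq_left (by linarith), max_eq_left hz0.le]
  have hw : u - K * (2 - c) * H ≤ z := by rw [hz]; nlinarith [mul_pos hKH0 hc0]
  have hKz : K * H ≤ 2 * b * z := by
    calc K * H = 2 * b * (K * H * c) := by
          rw [show 2 * b * (K * H * c) = K * H * (2 * b * c) by ring, hcb, mul_one]
      _ ≤ 2 * b * z := by gcongr
  have huz : u ≤ 5 * b * z := by
    have : u = z + (2 - 2 * c) * (K * H) := by rw [hz]; ring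
    have h2 : z ≤ b * z := by nlinarith
    nlinarith
  have hpow : u ^ (q - 1) ≤ μ * u := by
    have h1 : u ^ (q - 1) = u ^ (q - 2) * u := by
      rw [← Real.rpow_add_one hupos.ne']
      congr 1
      ring
    rw [h1]
    gcongr
    exact (Real.rpow_le_rpow_of_nonpos hK hu0.le (by linarith [hq.2])).trans hKμ
  have hfirst : u ^ (q - 1) * (u - K * (2 - c) * H) ≤ 5 * (b ^ 2 * μ * z ^ 2) := by
    calc u ^ (q - 1) * (u - K * (2 - c) * H) ≤ μ * u * z := by
          gcongr
      _ ≤ μ * (5 * b * z) * z := by gcongr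
      _ = 5 * b * (μ * z ^ 2) := by ring
      _ ≤ 5 * b ^ 2 * (μ * z ^ 2) := by
          gcongr
          nlinarith
      _ = _ := by ring
  have hsecond : (K * (2 - c)) ^ 2 * μ ≤ 16 * (b ^ 2 * μ * z ^ 2) := by
    have h1 : K * (2 - c) ≤ 4 * b * z := by nlinarith
    calc (K * (2 - c)) ^ 2 * μ ≤ (4 * b * z) ^ 2 * μ := by
          gcongr
          nlinarith
      _ = _ := by ring
  nlinarith

/-- The De Giorgi iteration: smallness of the `L²` norm above a level implies a bound. -/
theorem IsBoundedDensity.ae_le_of_lintegral_le {N : ℕ} (hN : 1 ≤ N) {s q : ℝ}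
    (hs : s ∈ Set.Ioo (0 : ℝ) 1) (hq : q ∈ Set.Ioo (1 : ℝ) 2) {U : Set (Pt N)}
    (hUm : MeasurableSet U) (hUfin : volume U < ⊤) {u H : Pt N → ℝ}
    (hd : IsBoundedDensity U s q u) (hu : Measurable u) (hu0 : ∀ x, 0 ≤ u x)
    (huU : ∀ x, x ∉ U → u x = 0) (hH : ContDiff ℝ ∞ H) (hH1 : ∀ x, 1 ≤ H x) {μ K ρ : ℝ}
    (hK : 0 < K) (hKμ : K ^ (q - 2) ≤ μ) (hρ : 0 < ρ)
    (hgrad : ∀ x, ∫⁻ y, ENNReal.ofReal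
      ((H x - H y) ^ 2 / ‖x - y‖ ^ ((N : ℝ) + 2 * s)) ≤ ENNReal.ofReal μ)
    (h1 : 8 * ∫⁻ x, ENNReal.ofReal (max (u x - K * H x) 0 ^ 2) ≤
      ENNReal.ofReal (unitVolume N * ρ ^ N * K ^ 2))
    (h2 : 296 * ρ ^ (2 * s) * μ ≤ unitVolume N * contraction N s) :
    ∀ᵐ x, u x ≤ 2 * K * H x := by
  have hs0 := hs.1
  have hHm : Measurable H := hH.continuous.measurable
  have hμ : 0 < μ := lt_of_lt_of_le (by positivity) hKμ
  have hω := unitVolume_pos N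
  set δ := contraction N s with hδ
  have hδ0 : 0 < δ := contraction_pos N s
  -- `τ^(2s) = 1/4` cancels the growth `4^j` in `henergy`; `δ = τ^N / 4` makes the Chebyshev factor
  -- `4^j δ^j` equal to the volume ratio of the balls of radii `ρ τ^j` and `ρ`.
  set τ : ℝ := (1 / 4 : ℝ) ^ (1 / (2 * s)) with hτ
  have hτ0 : 0 < τ := by positivity
  have hτs : τ ^ (2 * s) = 1 / 4 := by
    rw [hτ, ← Real.rpow_mul (by norm_num), one_div_mul_cancel (by positivity), Real.rpow_one]
  have hδτ : δ = τ ^ N / 4 := rfl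
  set k : ℕ → ℝ := fun j => K * (2 - 1 / 2 ^ j) with hk
  have hkK : ∀ j, K ≤ k j := fun j => by
    have : (1 : ℝ) / 2 ^ j ≤ 1 := by
      rw [div_le_one (by positivity)]
      exact one_le_pow₀ (by norm_num)
    simp only [hk]
    nlinarith
  have hk2 : ∀ j, k j ≤ 2 * K := fun j => by
    have : (0 : ℝ) < 1 / 2 ^ j := by positivity
    simp only [hk]
    nlinarith
  set Y : ℕ → ℝ≥0∞ := fun j => ∫⁻ x, ENNReal.ofReal (max (u x - k j * H x) 0 ^ 2) with hY
  have hY0 : 8 * Y 0 ≤ ENNReal.ofReal (unitVolume N * ρ ^ N * K ^ 2) := by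
    refine le_trans (le_of_eq ?_) h1
    simp only [hY, hk]
    norm_num
  have hdiff : ∀ j, k (j + 1) - k j = K / (2 * 2 ^ j) := fun j => by
    simp only [hk, pow_succ]
    field_simp
    ring
  -- Chebyshev's inequality: since `H ≥ 1`, consecutive levels differ by at least `K / (2 * 2^j)`.
  have hlevel : ∀ j, ENNReal.ofReal ((K / (2 * 2 ^ j)) ^ 2) *
      volume {x | k (j + 1) * H x < u x} ≤ Y j := by
    intro j
    have hA : MeasurableSet {x | k (j + 1) * H x < u x} :=
      measurableSet_lt (hHm.const_mul _) hu
    rw [← lintegral_indicator_const hA]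
    refine lintegral_mono fun x => ?_
    by_cases hx : k (j + 1) * H x < u x
    · rw [Set.indicator_of_mem (by exact hx)]
      refine ENNReal.ofReal_le_ofReal (pow_le_pow_left₀ (by positivity) ?_ 2)
      refine le_trans ?_ (le_max_left _ _)
      have h3 : K / (2 * 2 ^ j) ≤ (k (j + 1) - k j) * H x := by
        rw [hdiff]
        exact le_mul_of_one_le_right (by positivity) (hH1 x)
      nlinarith
    · rw [Set.indicator_of_notMem (by exact hx)]
      exact zero_le
  have henergy : ∀ j, energy s (fun x => max (u x - k (j + 1) * H x) 0) ≤
      ENNReal.ofReal (148 * (2 ^ j) ^ 2 * μ) * Y j := by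
    intro j
    have hkpos : 0 < k (j + 1) := hK.trans_le (hkK _)
    refine (hd.energy_posPart_le hN hs hq hUm hUfin hu hu0 huU (h := fun x => k (j + 1) * H x)
      (contDiff_const.mul hH) (fun x => mul_pos hkpos (by linarith [hH1 x]))
      (Γ := k (j + 1) ^ 2 * μ) (by positivity)
      (lintegral_gradient_const_mul_le hgrad _)).trans ?_
    rw [hY, ← lintegral_const_mul' _ _ (by finiteness)]
    refine lintegral_mono fun x => ?_
    by_cases hx : k (j + 1) * H x < u x
    · rw [Set.indicator_of_mem (by exact hx), ← ENNReal.ofReal_mul (by positivity)]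
      refine ENNReal.ofReal_le_ofReal ?_
      have hb : (1 : ℝ) ≤ 2 ^ j := one_le_pow₀ (by norm_num)
      have := level_step (u := u x) (H := H x) (b := 2 ^ j) hq hK hKμ (hH1 x) hb
      rw [← pow_succ'] at this
      exact this hx
    · rw [Set.indicator_of_notMem (by exact hx)]
      exact zero_le
  -- The bound at `j` makes the next support at most half a ball of radius `ρ τ^j`; Faber–Krahn at
  -- this radius then yields one more factor `δ`.
  have hind : ∀ j, Y j ≤ ENNReal.ofReal (δ ^ j) * Y 0 := by
    intro j
    induction j with
    | zero => simp
    | succ j ih =>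
      have hτj : 0 < ρ * τ ^ j := by positivity
      have hsupp : 2 * volume {x | max (u x - k (j + 1) * H x) 0 ≠ 0} ≤
          volume (ball (0 : Pt N) (ρ * τ ^ j)) := by
        have hset : {x | max (u x - k (j + 1) * H x) 0 ≠ 0} = {x | k (j + 1) * H x < u x} := by
          ext x
          simp
        rw [hset, volume_ball_eq _ hτj]
        have hc : ENNReal.ofReal ((K / (2 * 2 ^ j)) ^ 2) ≠ 0 := by
          rw [Ne, ENNReal.ofReal_eq_zero, not_le]
          positivity
        refine (ENNReal.mul_le_mul_iff_right hc ENNReal.ofReal_ne_top).1 ?_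
        calc ENNReal.ofReal ((K / (2 * 2 ^ j)) ^ 2) * (2 * volume {x | k (j + 1) * H x < u x})
            = 2 * (ENNReal.ofReal ((K / (2 * 2 ^ j)) ^ 2) *
              volume {x | k (j + 1) * H x < u x}) := by ring
          _ ≤ 2 * (ENNReal.ofReal (δ ^ j) * Y 0) := mul_le_mul' le_rfl ((hlevel j).trans ih)
          _ = ENNReal.ofReal (δ ^ j / 4) * (8 * Y 0) := by
            rw [ENNReal.ofReal_div_of_pos (by norm_num), ENNReal.ofReal_ofNat,
              show (8 : ℝ≥0∞) = 4 * 2 by norm_num, ENNReal.div_eq_inv_mul]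
            rw [show (4 : ℝ≥0∞)⁻¹ * ENNReal.ofReal (δ ^ j) * (4 * 2 * Y 0) =
              (4⁻¹ * 4) * (2 * (ENNReal.ofReal (δ ^ j) * Y 0)) by ring,
              ENNReal.inv_mul_cancel (by simp) (by simp), one_mul]
          _ ≤ ENNReal.ofReal (δ ^ j / 4) * ENNReal.ofReal (unitVolume N * ρ ^ N * K ^ 2) := by
            gcongr
          _ = _ := by
            rw [← ENNReal.ofReal_mul (by positivity), ← ENNReal.ofReal_mul (by positivity), hδτ]
            congr 1
            have e1 : (τ ^ N) ^ j = (τ ^ j) ^ N := by rw [← pow_mul, ← pow_mul, mul_comm]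
            have e2 : (4 : ℝ) ^ j = (2 ^ j) ^ 2 := by
              rw [← pow_mul, mul_comm, pow_mul]
              norm_num
            rw [div_pow, mul_pow ρ, e1, e2]
            field_simp
            norm_num
      have hFK := lintegral_sq_le_energy hs0 (u := fun x => max (u x - k (j + 1) * H x) 0)
        (by fun_prop) hτj hsupp
      have hω' : volume (ball (0 : Pt N) 1) = ENNReal.ofReal (unitVolume N) := by
        rw [volume_ball_eq _ one_pos, one_pow, mul_one]
      rw [hω'] at hFK
      have hstep : Y (j + 1) ≤ ENNReal.ofReal δ * Y j := by
        have hc : ENNReal.ofReal (unitVolume N) ≠ 0 := by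
          rw [Ne, ENNReal.ofReal_eq_zero, not_le]
          exact hω
        refine (ENNReal.mul_le_mul_iff_right hc ENNReal.ofReal_ne_top).1 ?_
        calc ENNReal.ofReal (unitVolume N) * Y (j + 1)
            ≤ 2 * ENNReal.ofReal ((ρ * τ ^ j) ^ (2 * s)) *
              (ENNReal.ofReal (148 * (2 ^ j) ^ 2 * μ) * Y j) :=
              hFK.trans (mul_le_mul' le_rfl (henergy j))
          _ = ENNReal.ofReal (296 * ρ ^ (2 * s) * μ) * Y j := by
            rw [← mul_assoc, ← ENNReal.ofReal_ofNat 2, ← ENNReal.ofReal_mul (by norm_num),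
              ← ENNReal.ofReal_mul (by positivity)]
            congr 2
            rw [Real.mul_rpow hρ.le (by positivity), ← Real.rpow_natCast τ j, ← Real.rpow_mul hτ0.le,
              mul_comm (j : ℝ), Real.rpow_mul hτ0.le, hτs, Real.rpow_natCast, ← pow_mul,
              mul_comm j 2, pow_mul]
            rw [div_pow, one_pow]
            norm_num
            field_simp
            norm_num
          _ ≤ ENNReal.ofReal (unitVolume N * δ) * Y j := by
            gcongr
          _ = _ := by rw [ENNReal.ofReal_mul hω.le, mul_assoc]
      calc Y (j + 1) ≤ ENNReal.ofReal δ * (ENNReal.ofReal (δ ^ j) * Y 0) :=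
            hstep.trans (mul_le_mul' le_rfl ih)
        _ = _ := by rw [← mul_assoc, ← ENNReal.ofReal_mul hδ0.le, pow_succ']
  have hY0fin : Y 0 ≠ ⊤ := by
    intro hcon
    rw [hcon, ENNReal.mul_top (by norm_num)] at hY0
    exact ENNReal.ofReal_ne_top (top_le_iff.1 hY0)
  have hlim : Tendsto (fun j => ENNReal.ofReal (δ ^ j) * Y 0) atTop (𝓝 0) := by
    have h3 := ENNReal.Tendsto.mul_const (b := Y 0) (ENNReal.tendsto_ofReal
      (tendsto_pow_atTop_nhds_zero_of_lt_one hδ0.le (contraction_lt_one N hs0)))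
      (Or.inr hY0fin)
    simpa using h3
  have hzero : ∫⁻ x, ENNReal.ofReal (max (u x - 2 * K * H x) 0 ^ 2) = 0 := by
    refine le_antisymm (ge_of_tendsto' hlim fun j => le_trans (lintegral_mono fun x => ?_)
      (hind j)) zero_le
    refine ENNReal.ofReal_le_ofReal (pow_le_pow_left₀ (le_max_right _ _) ?_ 2)
    refine max_le_max (sub_le_sub_left ?_ _) le_rfl
    exact mul_le_mul_of_nonneg_right (hk2 j) (by linarith [hH1 x])
  rw [lintegral_eq_zero_iff (by fun_prop)] at hzero
  filter_upwards [hzero] with x hx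
  by_contra hcon
  push Not at hcon
  have h3 : 0 < max (u x - 2 * K * H x) 0 ^ 2 := by
    have : 0 < max (u x - 2 * K * H x) 0 := lt_max_of_lt_left (by linarith)
    positivity
  rw [Pi.zero_apply, ENNReal.ofReal_eq_zero] at hx
  linarith

/-- Qualitative boundedness of the densities of sets of finite measure. -/
theorem IsBoundedDensity.exists_ae_le {N : ℕ} (hN : 1 ≤ N) {s q : ℝ}
    (hs : s ∈ Set.Ioo (0 : ℝ) 1) (hq : q ∈ Set.Ioo (1 : ℝ) 2) {U : Set (Pt N)}
    (hUm : MeasurableSet U) (hUfin : volume U < ⊤) {u : Pt N → ℝ}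
    (hd : IsBoundedDensity U s q u) (hu : Measurable u) (hu0 : ∀ x, 0 ≤ u x)
    (huU : ∀ x, x ∉ U → u x = 0) : ∃ M : ℝ, 0 < M ∧ ∀ᵐ x, u x ≤ M := by
  have hs0 := hs.1
  have hω := unitVolume_pos N
  have hδ := contraction_pos N s
  have h2 := lintegral_sq_lt_top hN hs0 hUfin hu huU (hd.1.1.energy_lt_top hN hs)
  set I := ∫⁻ x, ENNReal.ofReal (u x ^ 2) with hI
  set ρ : ℝ := (unitVolume N * contraction N s / 296) ^ (1 / (2 * s)) with hρ
  have hρ0 : 0 < ρ := by positivity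
  have hρs : ρ ^ (2 * s) = unitVolume N * contraction N s / 296 := by
    rw [hρ, ← Real.rpow_mul (by positivity), one_div_mul_cancel (by positivity), Real.rpow_one]
  -- The flat level `H = 1` has zero gradient, so `ρ` can be fixed first and `K` taken large against
  -- the finite `L²` norm.
  set K : ℝ := max 1 (8 * I.toReal / (unitVolume N * ρ ^ N)) with hK
  have hK1 : 1 ≤ K := le_max_left _ _
  have hKI : 8 * I.toReal ≤ unitVolume N * ρ ^ N * K ^ 2 := by
    have h3 : 8 * I.toReal / (unitVolume N * ρ ^ N) ≤ K := le_max_right _ _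
    rw [div_le_iff₀ (by positivity)] at h3
    calc 8 * I.toReal ≤ K * (unitVolume N * ρ ^ N) := h3
      _ ≤ K ^ 2 * (unitVolume N * ρ ^ N) := by
        gcongr
        nlinarith
      _ = _ := by ring
  have hμ1 : K ^ (q - 2) ≤ 1 := Real.rpow_le_one_of_one_le_of_nonpos hK1 (by linarith [hq.2])
  have := hd.ae_le_of_lintegral_le hN hs hq hUm hUfin hu hu0 huU (H := fun _ => 1)
    contDiff_const (fun _ => le_rfl) (μ := K ^ (q - 2)) (K := K) (ρ := ρ) (by linarith) le_rfl
    hρ0 (fun x => by simp) ?_ ?_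
  · refine ⟨2 * K * 1, by linarith, this⟩
  · calc 8 * ∫⁻ x, ENNReal.ofReal (max (u x - K * 1) 0 ^ 2) ≤ 8 * I := by
          refine mul_le_mul' le_rfl (lintegral_mono fun x => ENNReal.ofReal_le_ofReal ?_)
          exact pow_le_pow_left₀ (le_max_right _ _) (max_le (by linarith) (hu0 x)) 2
      _ = ENNReal.ofReal (8 * I.toReal) := by
          rw [ENNReal.ofReal_mul (by norm_num), ENNReal.ofReal_toReal h2.ne, ENNReal.ofReal_ofNat]
      _ ≤ _ := ENNReal.ofReal_le_ofReal hKI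
  · rw [hρs, mul_div_cancel₀ _ (by norm_num)]
    exact mul_le_of_le_one_right (by positivity) hμ1

/-! ### Halving the bound -/

/-- A smooth profile between `1` and `9` which is `1` near the origin and `9` far away. -/
theorem exists_profile (N : ℕ) : ∃ (P : Pt N → ℝ) (c : ℝ), 0 < c ∧ ContDiff ℝ ∞ P ∧
    (∀ x, 1 ≤ P x) ∧ (∀ x, ‖x‖ < 1 / 2 → P x = 1) ∧ (∀ x, 1 ≤ ‖x‖ → P x = 9) ∧
    ∀ x y, (P x - P y) ^ 2 ≤ c * min 1 (‖x - y‖ ^ 2) := by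
  set f : ContDiffBump (0 : Pt N) := ⟨1 / 2, 1, by norm_num, by norm_num⟩ with hf
  have hft : IsTestFunction Set.univ (f : Pt N → ℝ) :=
    ⟨f.contDiff, f.hasCompactSupport, Set.subset_univ _⟩
  obtain ⟨c, hc, hfc⟩ := hft.sq_sub_le
  refine ⟨fun x => 1 + 8 * (1 - f x), 64 * c, by positivity, ?_, fun x => ?_, fun x hx => ?_,
    fun x hx => ?_, fun x y => ?_⟩
  · exact contDiff_const.add (contDiff_const.mul (contDiff_const.sub f.contDiff))
  · have := f.le_one (x := x)
    linarith
  · beta_reduce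
    rw [f.one_of_mem_closedBall (by rw [mem_closedBall, dist_zero_right]; exact hx.le)]
    norm_num
  · beta_reduce
    rw [f.zero_of_le_dist (by rw [dist_zero_right]; exact hx)]
    norm_num
  · have := hfc x y
    nlinarith

/-- If the bound `M` of a density is large compared with the eigenvalue, it can be halved. -/
theorem exists_halving {N : ℕ} (hN : 1 ≤ N) {s : ℝ} (hs : s ∈ Set.Ioo (0 : ℝ) 1) :
    ∃ c : ℝ, 0 < c ∧ ∀ q ∈ Set.Ioo (1 : ℝ) 2, ∀ U : Set (Pt N), MeasurableSet U →
      volume U < ⊤ → ∀ u : Pt N → ℝ, IsBoundedDensity U s q u → Measurable u → (∀ x, 0 ≤ u x) →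
      (∀ x, x ∉ U → u x = 0) → ∀ l : ℝ, 0 < l →
      (∀ φ : Pt N → ℝ, IsTestFunction U φ →
        ENNReal.ofReal l * ∫⁻ x, ENNReal.ofReal (φ x ^ 2) ≤ energy s φ) →
      ∀ M : ℝ, 0 < M → (M / 8) ^ (q - 2) ≤ c * l → (∀ᵐ x, u x ≤ M) → ∀ᵐ x, u x ≤ M / 2 := by
  obtain ⟨P, c, hc, hP, hP1, hPin, hPout, hPc⟩ := exists_profile N
  have hs0 := hs.1
  have hω := unitVolume_pos N
  have hδ := contraction_pos N s
  have hT := truncConst_nonneg N s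
  set C : ℝ := c * truncConst N s + 1 with hC
  have hC0 : 0 < C := by positivity
  -- With `ρ = κ R`, this makes `296 * ρ^(2s) * μ` exactly the threshold `unitVolume N * contraction
  -- N s`.
  set κ : ℝ := (unitVolume N * contraction N s / (296 * C)) ^ (1 / (2 * s)) with hκ
  have hκ0 : 0 < κ := by positivity
  have hκs : κ ^ (2 * s) = unitVolume N * contraction N s / (296 * C) := by
    rw [hκ, ← Real.rpow_mul (by positivity), one_div_mul_cancel (by positivity), Real.rpow_one]
  -- `4224 = 8 * 2 * 264`: the `8` in the smallness condition, the `2` from `MemD.eigenvalue_le`,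
  -- and `264 = 4 * 64 + 8` from the energy bound.
  refine ⟨κ ^ N / 4224, by positivity, ?_⟩
  intro q hq U hUm hUfin u hd hu hu0 huU l hl heig M hM hMl hub
  set K : ℝ := M / 8 with hK
  have hK0 : 0 < K := by positivity
  set μ : ℝ := K ^ (q - 2) with hμ
  have hμ0 : 0 < μ := by positivity
  -- At this radius the squared fractional gradient of the rescaled profile is at most `μ`.
  set R : ℝ := (C / μ) ^ (1 / (2 * s)) with hR
  have hR0 : 0 < R := by positivity
  have hRs : R ^ (2 * s) = C / μ := by
    rw [hR, ← Real.rpow_mul (by positivity), one_div_mul_cancel (by positivity), Real.rpow_one]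
  have hlocal : ∀ x₀ : Pt N, ∀ᵐ x, x ∈ ball x₀ (R / 2) → u x ≤ M / 2 := by
    intro x₀
    set H : Pt N → ℝ := fun x => P (R⁻¹ • (x - x₀)) with hH
    have hHs : ContDiff ℝ ∞ H := hP.comp ((contDiff_id.sub contDiff_const).const_smul R⁻¹)
    have hH1 : ∀ x, 1 ≤ H x := fun x => hP1 _
    have hHm : Measurable H := hHs.continuous.measurable
    have hnorm : ∀ x, ‖R⁻¹ • (x - x₀)‖ = dist x x₀ / R := fun x => by
      rw [norm_smul, Real.norm_eq_abs, abs_of_pos (by positivity), dist_eq_norm, inv_mul_eq_div]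
    have hgrad : ∀ x, ∫⁻ y, ENNReal.ofReal
        ((H x - H y) ^ 2 / ‖x - y‖ ^ ((N : ℝ) + 2 * s)) ≤ ENNReal.ofReal μ := fun x => by
      refine (lintegral_gradient_le hN hs hc.le hR0 (fun x y => ?_) x).trans
        (ENNReal.ofReal_le_ofReal ?_)
      · refine (hPc _ _).trans (le_of_eq ?_)
        rw [← smul_sub, sub_sub_sub_cancel_right, norm_smul, Real.norm_eq_abs,
          abs_of_pos (by positivity), inv_mul_eq_div]
      · rw [Real.rpow_neg hR0.le, hRs, inv_div]
        calc c * truncConst N s * (μ / C) ≤ C * (μ / C) := by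
              gcongr
              linarith
          _ = μ := by field_simp
    have hKH : ∀ x, 0 < K * H x := fun x => mul_pos hK0 (by linarith [hH1 x])
    have hgradK := lintegral_gradient_const_mul_le hgrad K
    have hzD := hd.1.1.posPart_sub hN hs hUm hUfin (h := fun x => K * H x)
      (contDiff_const.mul hHs) hKH ENNReal.ofReal_ne_top hgradK
    have hEz := hd.energy_posPart_le hN hs hq hUm hUfin hu hu0 huU (h := fun x => K * H x)
      (contDiff_const.mul hHs) hKH (Γ := K ^ 2 * μ) (by positivity) hgradK
    have hEz2 : energy s (fun x => max (u x - K * H x) 0) ≤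
        ENNReal.ofReal (264 * μ * K ^ 2 * (unitVolume N * R ^ N)) := by
      rw [ENNReal.ofReal_mul (by positivity), ← volume_ball_eq x₀ hR0,
        ← lintegral_indicator_const measurableSet_ball]
      refine hEz.trans (lintegral_mono_ae ?_)
      filter_upwards [hub] with x hx
      by_cases hxA : K * H x < u x
      · have hxR : x ∈ ball x₀ R := by
          by_contra hcon
          rw [mem_ball, not_lt] at hcon
          have h9 : H x = 9 := hPout _ (by rw [hnorm, le_div_iff₀ hR0, one_mul]; exact hcon)
          rw [h9, hK] at hxA
          linarith
        rw [Set.indicator_of_mem (by exact hxA), Set.indicator_of_mem hxR]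
        refine ENNReal.ofReal_le_ofReal ?_
        have hKu : K ≤ u x := by nlinarith [hH1 x]
        have hu8 : u x ≤ 8 * K := by rw [hK]; linarith
        have hupos : 0 < u x := by linarith
        have hmax : max (u x - K * H x) 0 ≤ u x := max_le (by linarith [hKH x]) (hu0 x)
        have hpow : u x ^ (q - 1) ≤ μ * u x := by
          have h1 : u x ^ (q - 1) = u x ^ (q - 2) * u x := by
            rw [← Real.rpow_add_one hupos.ne']
            congr 1
            ring
          rw [h1]
          gcongr
          exact Real.rpow_le_rpow_of_nonpos hK0 hKu (by linarith [hq.2])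
        have : u x ^ (q - 1) * max (u x - K * H x) 0 ≤ 64 * μ * K ^ 2 := by
          calc u x ^ (q - 1) * max (u x - K * H x) 0 ≤ μ * u x * u x := by gcongr
            _ ≤ μ * (8 * K) * (8 * K) := by gcongr
            _ = _ := by ring
        linarith
      · rw [Set.indicator_of_notMem (by exact hxA)]
        exact zero_le
    have hY := (hzD.eigenvalue_le ENNReal.ofReal_ne_top heig).trans
      (mul_le_mul' le_rfl hEz2)
    have h8 : 8 * ∫⁻ x, ENNReal.ofReal (max (u x - K * H x) 0 ^ 2) ≤
        ENNReal.ofReal (unitVolume N * (κ * R) ^ N * K ^ 2) := by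
      have hl0 : ENNReal.ofReal l ≠ 0 := by
        rw [Ne, ENNReal.ofReal_eq_zero, not_le]
        exact hl
      refine (ENNReal.mul_le_mul_iff_right hl0 ENNReal.ofReal_ne_top).1 ?_
      calc ENNReal.ofReal l * (8 * ∫⁻ x, ENNReal.ofReal (max (u x - K * H x) 0 ^ 2))
          = 8 * (ENNReal.ofReal l * ∫⁻ x, ENNReal.ofReal (max (u x - K * H x) 0 ^ 2)) := by ring
        _ ≤ 8 * (2 * ENNReal.ofReal (264 * μ * K ^ 2 * (unitVolume N * R ^ N))) :=
          mul_le_mul' le_rfl hY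
        _ = ENNReal.ofReal (4224 * μ * (K ^ 2 * (unitVolume N * R ^ N))) := by
          rw [← mul_assoc, ← ENNReal.ofReal_ofNat 8, ← ENNReal.ofReal_ofNat 2,
            ← ENNReal.ofReal_mul (by norm_num), ← ENNReal.ofReal_mul (by norm_num)]
          congr 1
          ring
        _ ≤ ENNReal.ofReal (κ ^ N * l * (K ^ 2 * (unitVolume N * R ^ N))) := by
          refine ENNReal.ofReal_le_ofReal (mul_le_mul_of_nonneg_right ?_ (by positivity))
          linarith
        _ = _ := by
          rw [← ENNReal.ofReal_mul hl.le]
          congr 1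
          ring
    have hconc := hd.ae_le_of_lintegral_le hN hs hq hUm hUfin hu hu0 huU hHs hH1 hK0 le_rfl
      (mul_pos hκ0 hR0) hgrad h8 (le_of_eq (by
        rw [Real.mul_rpow hκ0.le hR0.le, hκs, hRs, ← hμ]
        field_simp))
    filter_upwards [hconc] with x hx hxb
    have hone : H x = 1 := hPin _ (by
      rw [hnorm, div_lt_iff₀ hR0]
      rw [mem_ball] at hxb
      linarith)
    rw [hone, hK] at hx
    linarith
  -- Countably many balls with dense centres cover the space, so the exceptional null sets can be
  -- united.
  have hall : ∀ᵐ x, ∀ n : ℕ, x ∈ ball (TopologicalSpace.denseSeq (Pt N) n) (R / 2) →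
      u x ≤ M / 2 := ae_all_iff.2 fun n => hlocal _
  filter_upwards [hall] with x hx
  obtain ⟨n, hn⟩ := (TopologicalSpace.denseRange_denseSeq (Pt N)).exists_dist_lt x
    (half_pos hR0)
  exact hx n hn

/-- The uniform bound of the densities of sets of finite measure. -/
theorem exists_bound_of_eigenvalue {N : ℕ} (hN : 1 ≤ N) {s : ℝ} (hs : s ∈ Set.Ioo (0 : ℝ) 1) :
    ∃ c : ℝ, 0 < c ∧ ∀ q ∈ Set.Ioo (1 : ℝ) 2, ∀ U : Set (Pt N), MeasurableSet U →
      volume U < ⊤ → ∀ u : Pt N → ℝ, IsBoundedDensity U s q u → ∀ l : ℝ, 0 < l →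
      (∀ φ : Pt N → ℝ, IsTestFunction U φ →
        ENNReal.ofReal l * ∫⁻ x, ENNReal.ofReal (φ x ^ 2) ≤ energy s φ) →
      ∀ᵐ x, u x ≤ 8 * (c * l) ^ (1 / (q - 2)) := by
  obtain ⟨c, hc, hhalf⟩ := exists_halving hN hs
  refine ⟨c, hc, fun q hq U hUm hUfin u' hd' l hl heig => ?_⟩
  obtain ⟨u, huu, hu, hu0, huU, hd⟩ := hd'.exists_representative hUm
  obtain ⟨M₀, hM₀, hb⟩ := hd.exists_ae_le hN hs hq hUm hUfin hu hu0 huU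
  set m : ℝ := 8 * (c * l) ^ (1 / (q - 2)) with hm
  have hm0 : 0 < m := by positivity
  have hq2 : q - 2 < 0 := by linarith [hq.2]
  have hmq : (m / 8) ^ (q - 2) = c * l := by
    rw [hm, mul_div_cancel_left₀ _ (by norm_num), ← Real.rpow_mul (by positivity),
      one_div_mul_cancel hq2.ne, Real.rpow_one]
  -- Halving is permitted exactly for bounds at least `m`, hence the maximum with `m`.
  have hiter : ∀ n : ℕ, ∀ᵐ x, u x ≤ max (M₀ / 2 ^ n) m := by
    intro n
    induction n with
    | zero =>
      filter_upwards [hb] with x hx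
      simp [hx]
    | succ n ih =>
      have hle : m ≤ max (M₀ / 2 ^ n) m := le_max_right _ _
      have := hhalf q hq U hUm hUfin u hd hu hu0 huU l hl heig (max (M₀ / 2 ^ n) m)
        (hm0.trans_le hle) (by
          rw [← hmq]
          exact Real.rpow_le_rpow_of_nonpos (by positivity) (by linarith) hq2.le) ih
      filter_upwards [this] with x hx
      refine hx.trans ?_
      rcases max_cases (M₀ / 2 ^ n) m with ⟨e, _⟩ | ⟨e, _⟩ <;> rw [e]
      · rw [pow_succ, ← div_div]
        exact le_max_left _ _
      · exact (by linarith : m / 2 ≤ m).trans (le_max_right _ _)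
  obtain ⟨n, hn⟩ := pow_unbounded_of_one_lt (M₀ / m) (one_lt_two)
  filter_upwards [hiter n, huu] with x hx hxu
  rw [hxu]
  refine hx.trans (max_le ?_ le_rfl)
  rw [div_le_iff₀ (by positivity), ← div_le_iff₀' hm0]
  exact hn.le

/-! ### Passage to arbitrary open sets -/

theorem IsTestFunction.integrable_sq {N : ℕ} {U : Set (Pt N)} {φ : Pt N → ℝ}
    (h : IsTestFunction U φ) : Integrable (fun x => φ x ^ 2) := by
  have hc : Continuous fun x => φ x ^ 2 := h.continuous.pow 2
  have hs : HasCompactSupport fun x => φ x ^ 2 :=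
    HasCompactSupport.of_support_subset_isCompact h.2.1.isCompact fun x hx =>
      subset_tsupport φ fun h0 => hx (by simp [h0])
  exact hc.integrable_of_hasCompactSupport hs

theorem setIntegral_abs_rpow_two {N : ℕ} {U : Set (Pt N)} {φ : Pt N → ℝ}
    (h : IsTestFunction U φ) : ∫ x in U, |φ x| ^ (2 : ℝ) = ∫ x, φ x ^ 2 := by
  simp only [Real.rpow_two, sq_abs]
  refine setIntegral_eq_integral_of_forall_compl_eq_zero fun x hx => ?_
  rw [h.eq_zero hx]
  norm_num

theorem lintegral_sq_eq {N : ℕ} {U : Set (Pt N)} {φ : Pt N → ℝ} (h : IsTestFunction U φ) :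
    ∫⁻ x, ENNReal.ofReal (φ x ^ 2) = ENNReal.ofReal (∫ x, φ x ^ 2) :=
  (ofReal_integral_eq_lintegral_ofReal h.integrable_sq (ae_of_all _ fun _ => sq_nonneg _)).symm

/-- Quadratic homogeneity removes the normalisation. If `φ` has zero `L²` norm the left side is `0`,
even for `l = ∞`. -/
theorem IsTestFunction.mul_lintegral_sq_le {N : ℕ} {s : ℝ} {Ω : Set (Pt N)} {l : ℝ≥0∞}
    (hl : l ≤ firstEigenvalue Ω s 2) {φ : Pt N → ℝ} (h : IsTestFunction Ω φ) :
    l * ∫⁻ x, ENNReal.ofReal (φ x ^ 2) ≤ energy s φ := by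
  rw [lintegral_sq_eq h]
  set I := ∫ x, φ x ^ 2 with hI
  have hI0 : 0 ≤ I := integral_nonneg fun x => sq_nonneg _
  rcases hI0.eq_or_lt with h0 | h0
  · simp [← h0]
  · have hc := h.const_mul (√I)⁻¹
    have hsq : (√I)⁻¹ ^ 2 = I⁻¹ := by rw [inv_pow, Real.sq_sqrt hI0]
    have h1 : ∫ x in Ω, |(√I)⁻¹ * φ x| ^ (2 : ℝ) = 1 := by
      rw [setIntegral_abs_rpow_two hc]
      simp only [mul_pow, hsq]
      rw [integral_const_mul, ← hI, inv_mul_cancel₀ h0.ne']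
    have h2 : l ≤ energy s (fun x => (√I)⁻¹ * φ x) :=
      hl.trans (iInf_le_of_le _ (iInf_le_of_le hc (iInf_le _ h1)))
    rw [energy_const_mul, hsq] at h2
    calc l * ENNReal.ofReal I ≤ ENNReal.ofReal I⁻¹ * energy s φ * ENNReal.ofReal I := by gcongr
      _ = ENNReal.ofReal (I⁻¹ * I) * energy s φ := by
        rw [ENNReal.ofReal_mul (by positivity)]
        ring
      _ = energy s φ := by rw [inv_mul_cancel₀ h0.ne', ENNReal.ofReal_one, one_mul]

theorem measurableSet_inter_ball {N : ℕ} {Ω : Set (Pt N)} (hΩ : IsOpen Ω) (r : ℝ) :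
    MeasurableSet (Ω ∩ ball 0 r) :=
  hΩ.measurableSet.inter measurableSet_ball

theorem volume_inter_ball_lt_top {N : ℕ} (Ω : Set (Pt N)) (r : ℝ) :
    volume (Ω ∩ ball 0 r) < ⊤ :=
  (measure_mono Set.inter_subset_right).trans_lt measure_ball_lt_top

theorem tendsto_natCast_add_atTop (a : ℝ) : Tendsto (fun n : ℕ => a + (n : ℝ)) atTop atTop :=
  tendsto_atTop_add_const_left _ _ tendsto_natCast_atTop_atTop

theorem IsLaneEmdenDensity.aestronglyMeasurable {N : ℕ} {s q : ℝ} {Ω : Set (Pt N)}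
    {w : Pt N → ℝ≥0∞} (hw : IsLaneEmdenDensity Ω s q w) :
    AEStronglyMeasurable w (volume.restrict Ω) := by
  obtain ⟨v, hv, hlim⟩ := hw
  refine (aemeasurable_of_tendsto_metrizable_ae atTop
    (f := fun (n : ℕ) x => ENNReal.ofReal (v (1 + n) x)) (fun n => ?_) ?_).aestronglyMeasurable
  · exact ((hv (1 + n) (by positivity)).1.1.aemeasurable.restrict).ennreal_ofReal
  · filter_upwards [hlim] with x hx
    exact hx.comp (tendsto_natCast_add_atTop 1)

/-- Uniform bound of a Lane–Emden density by the first eigenvalue. -/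
theorem exists_essSup_bound {N : ℕ} (hN : 1 ≤ N) {s : ℝ} (hs : s ∈ Set.Ioo (0 : ℝ) 1) :
    ∃ c : ℝ, 0 < c ∧ ∀ q ∈ Set.Ioo (1 : ℝ) 2, ∀ Ω : Set (Pt N), IsOpen Ω →
      ∀ w : Pt N → ℝ≥0∞, IsLaneEmdenDensity Ω s q w →
      ∀ l : ℝ, 0 < l → ENNReal.ofReal l ≤ firstEigenvalue Ω s 2 →
      eLpNorm w ∞ (volume.restrict Ω) ≤ ENNReal.ofReal (8 * (c * l) ^ (1 / (q - 2))) := by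
  obtain ⟨c, hc, hbound⟩ := exists_bound_of_eigenvalue hN hs
  refine ⟨c, hc, fun q hq Ω hΩ w hw l hl hle => ?_⟩
  obtain ⟨v, hv, hlim⟩ := hw
  -- Restricting to the radii `1 + n` leaves only countably many null sets.
  have hall : ∀ᵐ x, ∀ n : ℕ, v (1 + n) x ≤ 8 * (c * l) ^ (1 / (q - 2)) :=
    ae_all_iff.2 fun n => hbound q hq _ (measurableSet_inter_ball hΩ _)
      (volume_inter_ball_lt_top Ω _) _ (hv (1 + n) (by positivity)) l hl
      fun φ hφ => (hφ.mono Set.inter_subset_left).mul_lintegral_sq_le hle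
  rw [eLpNorm_exponent_top, eLpNormEssSup]
  refine essSup_le_of_ae_le _ ?_
  filter_upwards [hlim, ae_restrict_of_ae hall] with x hx hxv
  rw [enorm_eq_self]
  exact le_of_tendsto' (hx.comp (tendsto_natCast_add_atTop 1))
    fun n => ENNReal.ofReal_le_ofReal (hxv n)

/-- Lower bound of the energy of a normalised test function by a bound of the density. -/
theorem IsLaneEmdenDensity.rpow_le_energy {N : ℕ} (hN : 1 ≤ N) {s q : ℝ}
    (hs : s ∈ Set.Ioo (0 : ℝ) 1) (hq : q ∈ Set.Ioo (1 : ℝ) 2) {Ω : Set (Pt N)} (hΩ : IsOpen Ω)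
    {w : Pt N → ℝ≥0∞} (hw : IsLaneEmdenDensity Ω s q w) {φ : Pt N → ℝ}
    (hφ : IsTestFunction Ω φ) (hφ1 : ∫⁻ x, ENNReal.ofReal (φ x ^ 2) = 1) {m : ℝ} (hm : 0 < m)
    (hwm : ∀ᵐ x ∂(volume.restrict Ω), w x ≤ ENNReal.ofReal m) :
    ENNReal.ofReal (m ^ (q - 2)) ≤ energy s φ := by
  obtain ⟨v, hv, hlim⟩ := hw
  obtain ⟨r₀, hr₀⟩ := hφ.2.1.isCompact.isBounded.subset_ball (0 : Pt N)
  obtain ⟨B, hB0, hB⟩ := hφ.exists_bound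
  set r : ℕ → ℝ := fun n => max r₀ 1 + n with hr
  have hrpos : ∀ n, 0 < r n := fun n =>
    add_pos_of_pos_of_nonneg (lt_max_of_lt_right one_pos) (Nat.cast_nonneg n)
  have hrr : ∀ n, r₀ ≤ r n := fun n =>
    (le_max_left r₀ 1).trans (le_add_of_nonneg_right (Nat.cast_nonneg n))
  have hφn : ∀ n, IsTestFunction (Ω ∩ ball 0 (r n)) φ := fun n =>
    ⟨hφ.1, hφ.2.1, Set.subset_inter hφ.2.2 (hr₀.trans (ball_subset_ball (hrr n)))⟩
  have hφm := hφ.measurable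
  have hq2 : q / 2 - 1 ≤ 0 := by linarith [hq.2]
  have hn : ∀ t : ℝ, 0 < t → ∀ n, ∫⁻ x, ENNReal.ofReal
      (φ x ^ 2 * (v (r n) x ^ 2 + t * φ x ^ 2) ^ (q / 2 - 1)) ≤ energy s φ := by
    intro t ht n
    obtain ⟨u, huv, hu, hu0, huU, hd⟩ :=
      (hv (r n) (hrpos n)).exists_representative (measurableSet_inter_ball hΩ _)
    refine le_trans (le_of_eq (lintegral_congr_ae ?_)) (hd.lintegral_sq_mul_rpow_le hN hs hq
      (volume_inter_ball_lt_top Ω _) hu hu0 huU (hφn n) ht)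
    filter_upwards [huv] with x hx
    rw [hx]
  have hnonneg : ∀ᵐ x, ∀ n, φ x ≠ 0 → 0 ≤ v (r n) x := ae_all_iff.2 fun n => by
    have h1 := (hv (r n) (hrpos n)).1.2
    rw [ae_restrict_iff' (measurableSet_inter_ball hΩ _)] at h1
    filter_upwards [h1] with x hx hx0
    exact hx (by_contra fun hcon => hx0 ((hφn n).eq_zero hcon))
  rw [ae_restrict_iff' hΩ.measurableSet] at hlim hwm
  -- With `t > 0` the base of the negative power stays positive where `φ ≠ 0`, even if `w` vanishes
  -- there. Hence Fatou in `n` comes first, `t → 0` last.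
  have ht : ∀ t : ℝ, 0 < t → ENNReal.ofReal ((m ^ 2 + t * B ^ 2) ^ (q / 2 - 1)) ≤ energy s φ := by
    intro t ht
    calc ENNReal.ofReal ((m ^ 2 + t * B ^ 2) ^ (q / 2 - 1))
        = ∫⁻ x, ENNReal.ofReal ((m ^ 2 + t * B ^ 2) ^ (q / 2 - 1)) *
            ENNReal.ofReal (φ x ^ 2) := by
          rw [lintegral_const_mul' _ _ (by finiteness), hφ1, mul_one]
      _ ≤ ∫⁻ x, liminf (fun n => ENNReal.ofReal
            (φ x ^ 2 * (v (r n) x ^ 2 + t * φ x ^ 2) ^ (q / 2 - 1))) atTop := by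
          refine lintegral_mono_ae ?_
          filter_upwards [hlim, hwm, hnonneg] with x hx1 hx2 hx3
          by_cases h0 : φ x = 0
          · simp [h0]
          have hxΩ : x ∈ Ω := by_contra fun hcon => h0 (hφ.eq_zero hcon)
          have hwx := hx2 hxΩ
          have hwt : w x ≠ ⊤ := ne_top_of_le_ne_top ENNReal.ofReal_ne_top hwx
          have hlimv : Tendsto (fun n => v (r n) x) atTop (𝓝 (w x).toReal) := by
            have h1 := (ENNReal.tendsto_toReal hwt).comp
              ((hx1 hxΩ).comp (tendsto_natCast_add_atTop (max r₀ 1)))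
            refine h1.congr fun n => ?_
            exact ENNReal.toReal_ofReal (hx3 n h0)
          have hpos : 0 < (w x).toReal ^ 2 + t * φ x ^ 2 := by positivity
          have hlimF := ENNReal.tendsto_ofReal ((((hlimv.pow 2).add_const
            (t * φ x ^ 2)).rpow_const (p := q / 2 - 1) (Or.inl hpos.ne')).const_mul (φ x ^ 2))
          rw [hlimF.liminf_eq, ← ENNReal.ofReal_mul (by positivity), mul_comm]
          refine ENNReal.ofReal_le_ofReal (mul_le_mul_of_nonneg_left ?_ (sq_nonneg _))
          refine Real.rpow_le_rpow_of_nonpos hpos (add_le_add ?_ ?_) hq2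
          · exact pow_le_pow_left₀ ENNReal.toReal_nonneg
              (ENNReal.toReal_le_of_le_ofReal hm.le hwx) 2
          · refine mul_le_mul_of_nonneg_left ?_ ht.le
            rw [← sq_abs]
            exact pow_le_pow_left₀ (abs_nonneg _) (hB x) 2
      _ ≤ liminf (fun n => ∫⁻ x, ENNReal.ofReal
            (φ x ^ 2 * (v (r n) x ^ 2 + t * φ x ^ 2) ^ (q / 2 - 1))) atTop := by
          refine lintegral_liminf_le' fun n => ?_
          have := (hv (r n) (hrpos n)).1.1.aemeasurable
          exact ((hφm.aemeasurable.pow_const 2).mul (((this.pow_const 2).add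
            ((hφm.aemeasurable.pow_const 2).const_mul t)).pow_const _)).ennreal_ofReal
      _ ≤ liminf (fun _ : ℕ => energy s φ) atTop :=
          liminf_le_liminf (Eventually.of_forall (hn t ht))
      _ = energy s φ := liminf_const _
  have hmq : (m ^ 2 + 0 * B ^ 2) ^ (q / 2 - 1) = m ^ (q - 2) := by
    rw [zero_mul, add_zero, ← Real.rpow_natCast, ← Real.rpow_mul hm.le]
    congr 1
    push_cast
    ring
  have hcont : Tendsto (fun t : ℝ => ENNReal.ofReal ((m ^ 2 + t * B ^ 2) ^ (q / 2 - 1)))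
      (𝓝[>] 0) (𝓝 (ENNReal.ofReal (m ^ (q - 2)))) := by
    rw [← hmq]
    refine (ENNReal.tendsto_ofReal (Tendsto.rpow_const ?_
      (Or.inl (by positivity)))).mono_left nhdsWithin_le_nhds
    exact tendsto_const_nhds.add (tendsto_id.mul_const _)
  exact le_of_tendsto hcont (eventually_nhdsWithin_of_forall fun t h => ht t h)

end FracLaneEmden

/-! ### The two-sided estimate -/

theorem mainTheorem7 (N : ℕ) (hN : 1 ≤ N) (s : ℝ) (hs : s ∈ Set.Ioo (0 : ℝ) 1)
    (q : ℝ) (hq : q ∈ Set.Ioo (1 : ℝ) 2) :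
    (∃ C : ℝ≥0, 0 < C ∧
      ∀ Ω : Set (EuclideanSpace ℝ (Fin N)), IsOpen Ω →
      ∀ w : EuclideanSpace ℝ (Fin N) → ℝ≥0∞, FracLaneEmden.IsLaneEmdenDensity Ω s q w →
        0 < FracLaneEmden.firstEigenvalue Ω s 2 →
          MemLp w ∞ (volume.restrict Ω) ∧
          eLpNorm w ∞ (volume.restrict Ω) ^ (2 - q) ≤
            (C : ℝ≥0∞) * (FracLaneEmden.firstEigenvalue Ω s 2)⁻¹) ∧
    (∀ Ω : Set (EuclideanSpace ℝ (Fin N)), IsOpen Ω →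
      ∀ w : EuclideanSpace ℝ (Fin N) → ℝ≥0∞, FracLaneEmden.IsLaneEmdenDensity Ω s q w →
        MemLp w ∞ (volume.restrict Ω) →
          eLpNorm w ∞ (volume.restrict Ω) ^ (q - 2) ≤ FracLaneEmden.firstEigenvalue Ω s 2) := by
  have hq2 : 0 < 2 - q := by linarith [hq.2]
  constructor
  · obtain ⟨c, hc, hbound⟩ := FracLaneEmden.exists_essSup_bound hN hs
    have hrpow : ∀ l : ℝ, 0 < l → ENNReal.ofReal (8 * (c * l) ^ (1 / (q - 2))) ^ (2 - q) =
        ENNReal.ofReal (8 ^ (2 - q) / c) * (ENNReal.ofReal l)⁻¹ := by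
      intro l hl
      have hq2' : q - 2 ≠ 0 := by linarith
      rw [ENNReal.ofReal_rpow_of_pos (by positivity), ← ENNReal.ofReal_inv_of_pos hl,
        ← ENNReal.ofReal_mul (by positivity), Real.mul_rpow (by norm_num) (by positivity),
        ← Real.rpow_mul (by positivity), show 1 / (q - 2) * (2 - q) = -1 by field_simp; ring,
        Real.rpow_neg_one, mul_inv]
      congr 1
      ring
    refine ⟨(8 ^ (2 - q) / c).toNNReal, by simp only [Real.toNNReal_pos]; positivity,
      fun Ω hΩ w hw hpos => ?_⟩
    have hb : ∀ l : ℝ, 0 < l → ENNReal.ofReal l ≤ FracLaneEmden.firstEigenvalue Ω s 2 →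
        eLpNorm w ∞ (volume.restrict Ω) ^ (2 - q) ≤
          ENNReal.ofReal (8 ^ (2 - q) / c) * (ENNReal.ofReal l)⁻¹ := fun l hl hle => by
      rw [← hrpow l hl]
      exact ENNReal.rpow_le_rpow (hbound q hq Ω hΩ w hw l hl hle) hq2.le
    constructor
    · obtain ⟨l, hl0, hl⟩ := ENNReal.lt_iff_exists_nnreal_btwn.1 hpos
      refine ⟨hw.aestronglyMeasurable, lt_of_le_of_lt (hbound q hq Ω hΩ w hw l ?_ ?_)
        ENNReal.ofReal_lt_top⟩
      · exact_mod_cast hl0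
      · rw [ENNReal.ofReal_coe_nnreal]
        exact hl.le
    · change _ ≤ ENNReal.ofReal (8 ^ (2 - q) / c) * _
      -- An infinite eigenvalue, as for `Ω = ∅`, admits every finite `l`; letting `l → ∞` forces the
      -- norm to vanish.
      by_cases htop : FracLaneEmden.firstEigenvalue Ω s 2 = ⊤
      · rw [htop, ENNReal.inv_top, mul_zero]
        have hlim : Tendsto (fun n : ℕ => ENNReal.ofReal (8 ^ (2 - q) / c) *
            (ENNReal.ofReal ((n : ℝ) + 1))⁻¹) atTop (𝓝 0) := by
          have h1 : Tendsto (fun n : ℕ => (ENNReal.ofReal ((n : ℝ) + 1))⁻¹) atTop (𝓝 0) := by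
            rw [← ENNReal.inv_top]
            exact (ENNReal.tendsto_ofReal_atTop.comp
              (tendsto_atTop_add_const_right _ _ tendsto_natCast_atTop_atTop)).inv
          simpa using ENNReal.Tendsto.const_mul h1 (Or.inr ENNReal.ofReal_ne_top)
        exact ge_of_tendsto' hlim fun n => hb _ (by positivity) (by rw [htop]; exact le_top)
      · have := hb _ (ENNReal.toReal_pos hpos.ne' htop) ENNReal.ofReal_toReal_le
        rwa [ENNReal.ofReal_toReal htop] at this
  · intro Ω hΩ w hw hwL
    refine le_iInf fun φ => le_iInf fun hφ => le_iInf fun hφ1 => ?_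
    have hφ2 : ∫⁻ x, ENNReal.ofReal (φ x ^ 2) = 1 := by
      rw [FracLaneEmden.lintegral_sq_eq hφ, ← FracLaneEmden.setIntegral_abs_rpow_two hφ, hφ1,
        ENNReal.ofReal_one]
    have hae : ∀ᵐ x ∂(volume.restrict Ω), w x ≤ eLpNorm w ∞ (volume.restrict Ω) := by
      rw [eLpNorm_exponent_top]
      filter_upwards [ae_le_eLpNormEssSup (f := w) (μ := volume.restrict Ω)] with x hx
      rwa [enorm_eq_self] at hx
    have key : ∀ m : ℝ, 0 < m → eLpNorm w ∞ (volume.restrict Ω) ≤ ENNReal.ofReal m →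
        ENNReal.ofReal (m ^ (q - 2)) ≤ FracLaneEmden.energy s φ := fun m hm hle =>
      hw.rpow_le_energy hN hs hq hΩ hφ hφ2 hm (hae.mono fun x hx => hx.trans hle)
    rcases eq_or_ne (eLpNorm w ∞ (volume.restrict Ω)) 0 with h0 | h0
    · exfalso
      have hfin := hφ.energy_lt_top hN hs
      set e := (FracLaneEmden.energy s φ).toReal with he
      have he0 : 0 ≤ e := ENNReal.toReal_nonneg
      -- If `w` vanishes, every `m > 0` is admissible. This one has `m^(q-2) = e + 1`, more than the
      -- finite energy of `φ`, so no normalised test function exists.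
      have h1 := key ((e + 1) ^ (1 / (q - 2))) (by positivity) (by rw [h0]; exact zero_le)
      rw [← Real.rpow_mul (by positivity), one_div_mul_cancel (by linarith), Real.rpow_one,
        ← ENNReal.ofReal_toReal hfin.ne, ← he, ENNReal.ofReal_le_ofReal_iff he0] at h1
      linarith
    · have h1 := key _ (ENNReal.toReal_pos h0 hwL.2.ne) (ENNReal.ofReal_toReal hwL.2.ne).ge
      rwa [← ENNReal.ofReal_rpow_of_pos (ENNReal.toReal_pos h0 hwL.2.ne),
        ENNReal.ofReal_toReal hwL.2.ne] at h1
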